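/- Work over $\mathbb{C}$. Let $V=\mathbb{C}^5$ with standard basis $e_0,\dots,e_4$, let $p_{ij}$ ($0\le i<j\le 4$) be the Plücker coordinates on $\mathbb{P}(\wedge^2V)=\mathbb{P}^9$, and let $\mathrm{G}=\mathrm{Gr}(2,V)\subset\mathbb{P}^9$ be the Grassmannian of $2$-dimensional subspaces of $V$. Let $H_1=\{p_{12}-p_{03}=0\}$, $H_2=\{p_{13}-p_{24}=0\}$, and let $Y_5=\mathrm{G}\cap H_1$, $Y_4=\mathrm{G}\cap H_1\cap H_2$. Let $\mathcal{U}$ be the universal subbundle over $\mathrm{Gr}(4,V)$ and let $$\mathbf{S}(\mathrm{G})=\mathrm{Gr}(3,\wedge^2\mathcal{U})=\{(U,V_4) : V_4\subset V,\ \dim V_4=4,\ U\subset\wedge^2V_4,\ \dim U=3\}$$ be the Grassmannian bundle of $3$-dimensional subspaces over $\mathrm{Gr}(4,V)$. Let $T(\mathrm{G})\subset\mathbf{S}(\mathrm{G})$ be the indeterminacy locus of the rational map $(U,V_4)\mapsto\mathbb{P}(U)\cap\mathrm{Gr}(2,V_4)$ from $\mathbf{S}(\mathrm{G})$ to the Hilbert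 scheme of conics in $\mathrm{G}$, that is, the closed subset of all $(U,V_4)$ with $\mathbb{P}(U)\subset\mathrm{Gr}(2,V_4)$ (the relative orthogonal Grassmannian $\mathrm{OG}(3,\wedge^2\mathcal{U})$). For $m\in\{4,5\}$ let $$\mathcal{K}_m=\ker\bigl(\wedge^2\mathcal{U}\hookrightarrow\wedge^2V\otimes\mathcal{O}\to\mathcal{O}^{\oplus(6-m)}\bigr),$$ where the second map is given by the linear form $p_{12}-p_{03}$ if $m=5$ and by the two linear forms $p_{12}-p_{03}$, $p_{13}-p_{24}$ if $m=4$. Let $\mathbf{S}(Y_m)=\mathrm{Gr}(3,\mathcal{K}_m)\subset\mathbf{S}(\mathrm{G})$, and let $T(Y_m)=\mathbf{S}(Y_m)\cap T(\mathrm{G})$ be the set-theoretic intersection. All these closed subsets carry their reduced structure, and $I_{Z,\mathbf{S}(\mathrm{G})}$ denotes the ideal sheaf of $Z$ in $\mathcal{O}_{\mathbf{S}(\mathrm{G})}$. **Theorem.** For $m=4,5$, $$I_{T(Y_m),\,\mathbf{S}(\mathrm{G})}=I_{T(\mathrm{G}),\,\mathbf{S}(\mathrm{G})}+I_{\mathbf{S}(Y_m),\,\mathbf{S}(\mathrm{G})}$$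 as ideal sheaves on $\mathbf{S}(\mathrm{G})$, and $T(Y_m)$ is nonsingular. That is, $\mathbf{S}(Y_m)$ and $T(\mathrm{G})$ intersect cleanly in $\mathbf{S}(\mathrm{G})$: their scheme-theoretic intersection is the nonsingular variety $T(Y_m)$, which may be disconnected. -/

import Mathlib

open Filter Topology

noncomputable section

namespace QuinticDelPezzo

/-- The vector space `V = ℂ⁵` with its standard coordinates `e₀, …, e₄`. -/
abbrev V : Type := Fin 5 → ℂ

/-- The exterior square `∧²V`. -/
abbrev Wedge2 : Type := ⋀[ℂ]^2 V

/-- The decomposable bivector `v ∧ w`. -/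
def wedge (v w : V) : Wedge2 := exteriorPower.ιMulti ℂ 2 ![v, w]

/-- The coordinate `p_{ij} = e_i^* ∧ e_j^*` as a linear form on `∧²V`, so that
`p_{ij}(v ∧ w) = v_i w_j - v_j w_i`. -/
def p (i j : Fin 5) : Wedge2 →ₗ[ℂ] ℂ :=
  exteriorPower.pairingDual ℂ V 2
    (exteriorPower.ιMulti ℂ 2 ![LinearMap.proj i, LinearMap.proj j])

lemma p_wedge (i j : Fin 5) (v w : V) : p i j (wedge v w) = v i * w j - v j * w i := by
  simp [p, wedge, exteriorPower.pairingDual_ιMulti_ιMulti, Matrix.det_fin_two]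

/-- The subspace `∧²W ⊆ ∧²V` for a subspace `W ⊆ V`. -/
def wedge2Sub (W : Submodule ℂ V) : Submodule ℂ Wedge2 :=
  LinearMap.range (exteriorPower.map 2 W.subtype)

/-- The (closed) points of `S(G) = Gr(3, ∧²𝒰)`, the Grassmannian bundle over `Gr(4, V)`:
pairs `(U, V₄)` with `V₄ ⊆ V` of dimension `4` and `U ⊆ ∧²V₄` of dimension `3`. -/
@[ext]
structure SG where
  V4 : Submodule ℂ V
  U : Submodule ℂ Wedge2
  finrank_V4 : Module.finrank ℂ V4 = 4
  finrank_U : Module.finrank ℂ U = 3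
  U_le : U ≤ wedge2Sub V4

/-! ### The structure of an algebraic variety on `S(G)`

`S(G)` is the incidence variety in `Gr(3, ∧²V) × Gr(4, V)`, a closed subvariety of a product of two
projective spaces by means of the Plücker coordinates of `V₄` and of `U`.  Closed sets are zero loci
of bihomogeneous polynomials in these coordinates, and regular functions are, locally, quotients of
two bihomogeneous polynomials of the same bidegree. -/

/-- A basis of `V₄` together with a basis of `U`. -/
structure Frame (x : SG) where
  a : Module.Basis (Fin 4) ℂ x.V4
  b : Module.Basis (Fin 3) ℂ x.U

/-- Indices of Plücker coordinates: sequences of four coordinates of `V` (for `V₄ ⊆ V`) and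
sequences of three coordinates `p_{ij}` of `∧²V` (for `U ⊆ ∧²V`). -/
abbrev PluckerIndex : Type := (Fin 4 → Fin 5) ⊕ (Fin 3 → Fin 5 × Fin 5)

/-- The Plücker coordinates of `V₄` and of `U` with respect to a frame: the maximal minors of the
coordinate matrices of the two bases. -/
def Frame.plucker {x : SG} (F : Frame x) : PluckerIndex → ℂ
  | Sum.inl I => Matrix.det (Matrix.of fun k l : Fin 4 => (F.a k : V) (I l))
  | Sum.inr J => Matrix.det (Matrix.of fun k l : Fin 3 => p (J l).1 (J l).2 (F.b k : Wedge2))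

/-- `P` is bihomogeneous of bidegree `d` in the Plücker coordinates of `V₄` and of `U`. -/
def IsBihomogeneous (P : MvPolynomial PluckerIndex ℂ) (d : ℕ × ℕ) : Prop :=
  MvPolynomial.IsWeightedHomogeneous
    (Sum.elim (fun _ => (1, 0)) (fun _ => (0, 1)) : PluckerIndex → ℕ × ℕ) P d

/-- The locus where a (bihomogeneous) polynomial in the Plücker coordinates does not vanish. -/
def basicOpen (P : MvPolynomial PluckerIndex ℂ) : Set SG :=
  {x | ∀ F : Frame x, MvPolynomial.eval F.plucker P ≠ 0}

/-- The Zariski topology of `S(G)`. -/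
instance zariski : TopologicalSpace SG :=
  TopologicalSpace.generateFrom {D | ∃ P d, IsBihomogeneous P d ∧ D = basicOpen P}

/-- The function `f` is regular at `x`: near `x` it is a quotient of two bihomogeneous polynomials
of the same bidegree in the Plücker coordinates, with nowhere vanishing denominator. -/
def RegularAt (f : SG → ℂ) (x : SG) : Prop :=
  ∃ (d : ℕ × ℕ) (P Q : MvPolynomial PluckerIndex ℂ), IsBihomogeneous P d ∧ IsBihomogeneous Q d ∧
    ∀ᶠ y in 𝓝 x, ∀ F : Frame y, MvPolynomial.eval F.plucker Q ≠ 0 ∧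
      f y = MvPolynomial.eval F.plucker P / MvPolynomial.eval F.plucker Q

lemma RegularAt.const (c : ℂ) (x : SG) : RegularAt (fun _ => c) x :=
  ⟨0, MvPolynomial.C c, 1, MvPolynomial.isWeightedHomogeneous_C _ _,
    MvPolynomial.isWeightedHomogeneous_one _ _, Eventually.of_forall fun y F => by simp⟩

lemma RegularAt.add {f g : SG → ℂ} {x : SG} (hf : RegularAt f x) (hg : RegularAt g x) :
    RegularAt (f + g) x := by
  obtain ⟨d, P, Q, hP, hQ, h⟩ := hf
  obtain ⟨d', P', Q', hP', hQ', h'⟩ := hg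
  refine ⟨d + d', P * Q' + Q * P', Q * Q', (hP.mul hQ').add (hQ.mul hP'), hQ.mul hQ', ?_⟩
  filter_upwards [h, h'] with y hy hy' F
  obtain ⟨h1, h2⟩ := hy F
  obtain ⟨h3, h4⟩ := hy' F
  simp only [map_mul, map_add, Pi.add_apply, h2, h4]
  exact ⟨mul_ne_zero h1 h3, div_add_div _ _ h1 h3⟩

lemma RegularAt.mul {f g : SG → ℂ} {x : SG} (hf : RegularAt f x) (hg : RegularAt g x) :
    RegularAt (f * g) x := by
  obtain ⟨d, P, Q, hP, hQ, h⟩ := hf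
  obtain ⟨d', P', Q', hP', hQ', h'⟩ := hg
  refine ⟨d + d', P * P', Q * Q', hP.mul hP', hQ.mul hQ', ?_⟩
  filter_upwards [h, h'] with y hy hy' F
  obtain ⟨h1, h2⟩ := hy F
  obtain ⟨h3, h4⟩ := hy' F
  simp only [map_mul, Pi.mul_apply, h2, h4]
  exact ⟨mul_ne_zero h1 h3, div_mul_div_comm _ _ _ _⟩

/-- Germs of complex-valued functions form a `ℂ`-algebra. -/
instance germAlgebra {α : Type} (l : Filter α) : Algebra ℂ (Germ l ℂ) :=
  Algebra.ofModule
    (fun r φ ψ => Germ.inductionOn₂ φ ψ fun f g => congrArg (Germ.ofFun (l := l)) (smul_mul_assoc r f g))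
    (fun r φ ψ => Germ.inductionOn₂ φ ψ fun f g => congrArg (Germ.ofFun (l := l)) (mul_smul_comm r f g))

/-- The local ring `𝒪_{S(G), x}`: germs at `x`, for the Zariski topology, of regular functions. -/
def localRing (x : SG) : Subalgebra ℂ (Germ (𝓝 x) ℂ) where
  carrier := {φ | ∃ f : SG → ℂ, RegularAt f x ∧ φ = (f : Germ (𝓝 x) ℂ)}
  mul_mem' := by
    rintro _ _ ⟨f, hf, rfl⟩ ⟨g, hg, rfl⟩
    exact ⟨f * g, hf.mul hg, rfl⟩
  add_mem' := by
    rintro _ _ ⟨f, hf, rfl⟩ ⟨g, hg, rfl⟩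
    exact ⟨f + g, hf.add hg, rfl⟩
  algebraMap_mem' c := ⟨fun _ => c, RegularAt.const c x, by
    rw [Algebra.algebraMap_eq_smul_one]
    exact congrArg (Germ.ofFun (l := 𝓝 x)) (funext fun _ => by simp)⟩

/-- The stalk at `x` of the ideal sheaf `I_{Z, S(G)}` of a closed subset `Z` of `S(G)` with its
reduced structure: germs of regular functions at `x` that vanish on `Z` near `x`. -/
def idealAt (Z : Set SG) (x : SG) : Ideal (localRing x) where
  carrier := {φ | ∃ f : SG → ℂ, (φ : Germ (𝓝 x) ℂ) = f ∧ ∀ᶠ y in 𝓝 x, y ∈ Z → f y = 0}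
  zero_mem' := ⟨0, rfl, Eventually.of_forall fun _ _ => rfl⟩
  add_mem' := by
    rintro φ ψ ⟨f, hf, hf'⟩ ⟨g, hg, hg'⟩
    refine ⟨f + g, by rw [Subalgebra.coe_add, hf, hg]; rfl, ?_⟩
    filter_upwards [hf', hg'] with y h1 h2 hy
    simp [h1 hy, h2 hy]
  smul_mem' := by
    rintro ⟨_, g, _, rfl⟩ φ ⟨f, hf, hf'⟩
    refine ⟨g * f, by rw [smul_eq_mul, Subalgebra.coe_mul, hf]; rfl, ?_⟩
    filter_upwards [hf'] with y h1 hy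
    simp [h1 hy]

/-- The closed subset `Z` with its reduced structure is nonsingular (smooth over `ℂ`) at `x`: its
local ring `𝒪_{Z, x} = 𝒪_{S(G), x} / I_{Z, x}`, a local ring of a variety, is formally smooth over
`ℂ`. -/
def IsNonsingularAt (Z : Set SG) (x : SG) : Prop :=
  Algebra.FormallySmooth ℂ (localRing x ⧸ idealAt Z x)

/-! ### The subvarieties `T(G)`, `S(Y_m)` and `T(Y_m)` -/

/-- `T(G) ≅ OG(3, ∧²𝒰)`, the indeterminacy locus of the rational map `(U, V₄) ↦ ℙ(U) ∩ Gr(2, V₄)`: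
the pairs with `ℙ(U) ⊆ Gr(2, V₄)`, that is, every element of `U` is of the form `v ∧ w` with
`v, w ∈ V₄`. -/
def TG : Set SG :=
  {x | ∀ u ∈ x.U, ∃ v ∈ x.V4, ∃ w ∈ x.V4, u = wedge v w}

/-- The linear forms defining `H₁ = {p₁₂ - p₀₃ = 0}` and `H₂ = {p₁₃ - p₂₄ = 0}`. -/
def hyperplane : Fin 2 → (Wedge2 →ₗ[ℂ] ℂ) :=
  ![p 1 2 - p 0 3, p 1 3 - p 2 4]

/-- The fibre at `V₄` of `𝒦_m = ker(∧²𝒰 → 𝒪^{6 - m})`, where the map is given by the first `6 - m`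
of the linear forms defining `H₁`, `H₂` (`m = 4, 5`). -/
def K (m : ℕ) (V4 : Submodule ℂ V) : Submodule ℂ Wedge2 :=
  wedge2Sub V4 ⊓ ⨅ (i : Fin 2) (_ : (i : ℕ) + m < 6), LinearMap.ker (hyperplane i)

/-- `S(Y_m) = Gr(3, 𝒦_m) ⊆ S(G)`. -/
def SY (m : ℕ) : Set SG := {x | x.U ≤ K m x.V4}

/-- `T(Y_m)`, the set-theoretic intersection of `S(Y_m)` and `T(G)`. -/
def TY (m : ℕ) : Set SG := SY m ∩ TG

end QuinticDelPezzo

end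

/-!
The statement is local on `S(G)`. Away from `T(Y_m)` one of `T(G)`, `S(Y_m)` misses a neighbourhood of
the point, because both are closed (`eventually_notMem_TG`, `eventually_notMem_SY`), and all ideals in
question are the unit ideal.

At a point `x = (U, V₄)` of `T(Y_m)` everything can be written down in one affine chart. A basis
`E` of `V` and three of the six pairs of indices below `4` give a chart of `S(G)`: `V₄` has a basis
`a_k = E_k + t_k E_4`, and `U` has a basis whose coordinates `c` with respect to the `a_i ∧ a_j` form
the identity matrix at the three pairs (`IsChartPoint`). The coordinates `t`, `c` are regular
functions by Cramer's rule (`IsChartPoint.exists_regular`). In the chart, `T(G)` is given by the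
isotropy of `U` for the Plücker quadric of `∧²V₄` (`IsChartPoint.mem_TG_iff`), and `S(Y_m)` by the
vanishing of one or two linear forms on `U`, which are explicit polynomials in `t`, `c` once `E` puts
these forms into a standard shape (`IsChartPoint.mem_SY_iff`).

The points of `T(Y_m)` have few normal forms. A plane in `Gr(2, V₄)` consists of the lines through a
point or of the lines in a plane of `ℙ(V₄)` (`point_or_plane_of_mem_TG`). For `m = 5`, a symplectic
basis can be chosen compatibly with `V₄` and with the point or plane
(`exists_basis_of_mem_TY_five`). For `m = 4`, the kernels of the members of the pencil of alternating
forms trace out a conic; the point lies on that conic (`exists_conic_point`), or the plane is the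
one that the conic spans, and the standard basis can be moved along the conic
(`exists_basis_of_mem_TY_four`). Hence `x` is the origin of one of five charts, adapted to the forms.

In each of the five charts the equations of `T(G)` and of `S(Y_m)` taken together can be solved:
all chart coordinates are polynomials in some of them, the free ones, over every commutative
`ℂ`-algebra in which the equations hold (`Parametrization`). Applied to the quotient of the local
ring at `x` by `I_{T(G)} + I_{S(Y_m)}`, this shows that the quotient is generated, up to denominators,
by the free coordinates. Applied to `ℂ`, it provides a family of points of `T(Y_m)` with arbitrary
free coordinates, so that no nonzero polynomial in them vanishes on `T(Y_m)` near `x`. Therefore the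
quotient is the local ring of an affine space at the origin, which is formally smooth over `ℂ`, and
`I_{T(G)} + I_{S(Y_m)}` contains every germ that vanishes on `T(Y_m)`
(`Parametrization.local_structure`).
-/

namespace QuinticDelPezzo

/-! ### Frames dual to linear forms -/

/-- The vectors `b k` lie in `W` and are dual to the linear forms `Φ l`. When `W` has dimension `n`
they form the unique basis of `W` with this property. -/
structure IsDualFrame {M : Type*} [AddCommGroup M] [Module ℂ M] {n : ℕ} (W : Submodule ℂ M)
    (Φ : Fin n → M →ₗ[ℂ] ℂ) (b : Fin n → M) : Prop where
  mem : ∀ k, b k ∈ W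
  dual : ∀ k l, Φ l (b k) = if k = l then 1 else 0

namespace IsDualFrame

variable {M : Type*} [AddCommGroup M] [Module ℂ M] {n : ℕ} {W : Submodule ℂ M}
  {Φ : Fin n → M →ₗ[ℂ] ℂ} {b : Fin n → M}

lemma exists_basis [NeZero n] (h : IsDualFrame W Φ b) (hW : Module.finrank ℂ W = n) :
    ∃ B : Module.Basis (Fin n) ℂ W, ∀ k, (B k : M) = b k := by
  have hli : LinearIndependent ℂ (fun k => (⟨b k, h.mem k⟩ : W)) := by
    rw [Fintype.linearIndependent_iff]
    intro g hg i
    have h1 := congrArg (fun w : W => Φ i w) hg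
    simpa [h.dual] using h1
  refine ⟨basisOfLinearIndependentOfCardEqFinrank hli (by simp [hW]), fun k => by simp⟩

lemma eq_sum [NeZero n] (h : IsDualFrame W Φ b) (hW : Module.finrank ℂ W = n) {w : M}
    (hw : w ∈ W) : w = ∑ k, Φ k w • b k := by
  obtain ⟨B, hB⟩ := h.exists_basis hW
  have h1 := congrArg (fun w : W => (w : M)) (B.sum_repr ⟨w, hw⟩)
  simp only [Submodule.coe_sum, Submodule.coe_smul, hB] at h1
  have h2 : ∀ k, Φ k w = B.repr ⟨w, hw⟩ k := by
    intro k
    have h3 := congrArg (Φ k) h1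
    simpa [h.dual] using h3.symm
  simp only [h2]
  exact h1.symm

lemma unique [NeZero n] {b' : Fin n → M} (h : IsDualFrame W Φ b) (h' : IsDualFrame W Φ b')
    (hW : Module.finrank ℂ W = n) : b = b' := by
  funext k
  rw [h.eq_sum hW (h'.mem k)]
  simp [h'.dual]

/-- Linear forms with a dual frame have a nonzero minor with respect to every basis. -/
lemma det_ne_zero (h : IsDualFrame W Φ b) (B : Module.Basis (Fin n) ℂ W) :
    Matrix.det (Matrix.of fun k l => Φ l (B k : M)) ≠ 0 := by
  have h1 : (Matrix.of fun k j => B.repr ⟨b k, h.mem k⟩ j) *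
      (Matrix.of fun k l => Φ l (B k : M)) = 1 := by
    ext k l
    have h2 := congrArg (fun w : W => Φ l (w : M)) (B.sum_repr ⟨b k, h.mem k⟩)
    simp only [Submodule.coe_sum, Submodule.coe_smul, map_sum, map_smul, h.dual] at h2
    simpa [Matrix.mul_apply, Matrix.one_apply] using h2
  intro h0
  have h3 := congrArg Matrix.det h1
  rw [Matrix.det_mul, h0] at h3
  simp at h3

lemma exists_of_det_ne_zero (B : Module.Basis (Fin n) ℂ W)
    (h : Matrix.det (Matrix.of fun k l => Φ l (B k : M)) ≠ 0) : ∃ b, IsDualFrame W Φ b := by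
  set A := Matrix.of fun k l => Φ l (B k : M) with hA
  refine ⟨fun k => ∑ j, A⁻¹ k j • (B j : M), fun k => W.sum_mem fun j _ =>
    W.smul_mem _ (B j).2, fun k l => ?_⟩
  have h1 : (A⁻¹ * A) k l = (1 : Matrix _ _ ℂ) k l := by
    rw [Matrix.nonsing_inv_mul _ (isUnit_iff_ne_zero.mpr h)]
  rw [Matrix.one_apply, Matrix.mul_apply] at h1
  simpa [hA] using h1

/-- Cramer's rule for the value of a linear form on a dual frame. -/
lemma apply_mul_det [NeZero n] (h : IsDualFrame W Φ b) (B : Module.Basis (Fin n) ℂ W)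
    (ψ : M →ₗ[ℂ] ℂ) (k : Fin n) :
    ψ (b k) * Matrix.det (Matrix.of fun k l => Φ l (B k : M)) =
      Matrix.det (Matrix.of fun j l => Function.update Φ k ψ l (B j : M)) := by
  have hW : Module.finrank ℂ W = n := by simp [Module.finrank_eq_card_basis B]
  set A := Matrix.of fun k l => Φ l (B k : M) with hA
  have h1 : A.mulVec (fun l => ψ (b l)) = fun j => ψ (B j : M) := by
    funext j
    conv_rhs => rw [h.eq_sum hW (B j).2]
    simp [Matrix.mulVec, dotProduct, hA]
  have h2 : (Matrix.of fun j l => Function.update Φ k ψ l (B j : M)) =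
      A.updateCol k (fun j => ψ (B j : M)) := by
    ext j l
    rw [Matrix.updateCol_apply]
    by_cases hl : l = k
    · subst hl; simp
    · simp [hl, hA]
  rw [h2, ← Matrix.cramer_apply, ← h1, Matrix.cramer_eq_adjugate_mulVec, Matrix.mulVec_mulVec,
    Matrix.adjugate_mul]
  simp [Matrix.smul_mulVec, mul_comm]

end IsDualFrame

/-! ### Plücker coordinates of linear forms -/

/-- Maximal minors of linear forms are linear combinations of maximal minors of given linear forms
that span the dual space. -/
lemma det_of_sum {M ι : Type*} [AddCommGroup M] [Module ℂ M] [Fintype ι] {n : ℕ}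
    (e : ι → M →ₗ[ℂ] ℂ) (c : Fin n → ι → ℂ) (B : Fin n → M) :
    Matrix.det (Matrix.of fun k l => (∑ r, c l r • e r) (B k)) =
      ∑ J : Fin n → ι, (∏ l, c l (J l)) * Matrix.det (Matrix.of fun k l => e (J l) (B k)) := by
  classical
  have h0 : ∀ A : Fin n → Fin n → ℂ, Matrix.det (Matrix.of fun k l => A l k) =
      Matrix.detRowAlternating (R := ℂ) A := by
    intro A
    rw [← Matrix.det_transpose]; rfl
  rw [h0 (fun l k => (∑ r, c l r • e r) (B k))]
  have h1 : (fun l k => (∑ r, c l r • e r) (B k)) =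
      fun l : Fin n => ∑ r, c l r • (fun k => e r (B k)) := by
    funext l k
    simp
  rw [h1]
  have h2 := (Matrix.detRowAlternating (R := ℂ) (n := Fin n)).toMultilinearMap.map_sum
    (fun l (r : ι) => c l r • (fun k => e r (B k)))
  simp only [AlternatingMap.coe_multilinearMap] at h2
  rw [h2]
  refine Finset.sum_congr rfl fun J _ => ?_
  have h3 := (Matrix.detRowAlternating (R := ℂ) (n := Fin n)).toMultilinearMap.map_smul_univ
    (fun l => c l (J l)) (fun l k => e (J l) (B k))
  simp only [AlternatingMap.coe_multilinearMap] at h3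
  rw [h3, h0 (fun l k => e (J l) (B k)), smul_eq_mul]

/-- The linear form `φ ∧ ψ` on `∧²V`. -/
noncomputable def pairForm (φ ψ : V →ₗ[ℂ] ℂ) : Wedge2 →ₗ[ℂ] ℂ :=
  exteriorPower.pairingDual ℂ V 2 (exteriorPower.ιMulti ℂ 2 ![φ, ψ])

lemma pairForm_wedge (φ ψ : V →ₗ[ℂ] ℂ) (v w : V) :
    pairForm φ ψ (wedge v w) = φ v * ψ w - ψ v * φ w := by
  simp [pairForm, wedge, exteriorPower.pairingDual_ιMulti_ιMulti, Matrix.det_fin_two]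

lemma wedge2_ext {N : Type*} [AddCommGroup N] [Module ℂ N] {f g : Wedge2 →ₗ[ℂ] N}
    (h : ∀ v w, f (wedge v w) = g (wedge v w)) : f = g := by
  refine exteriorPower.linearMap_ext ?_
  ext v
  have : v = ![v 0, v 1] := by ext i; fin_cases i <;> rfl
  rw [this]
  exact h _ _

lemma update_pair_zero (u v w : V) : Function.update ![v, w] 0 u = ![u, w] := by
  ext i; fin_cases i <;> rfl

lemma update_pair_one (u v w : V) : Function.update ![v, w] 1 u = ![v, u] := by
  ext i; fin_cases i <;> rfl

/-- `wedge` as a bilinear map. -/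
noncomputable def wedgeₗ : V →ₗ[ℂ] V →ₗ[ℂ] Wedge2 :=
  LinearMap.mk₂ ℂ wedge
    (fun v v' w => by
      have := (exteriorPower.ιMulti ℂ 2 (M := V)).map_update_add ![v, w] 0 v v'
      simp only [update_pair_zero] at this
      exact this)
    (fun c v w => by
      have := (exteriorPower.ιMulti ℂ 2 (M := V)).map_update_smul ![v, w] 0 c v
      simp only [update_pair_zero] at this
      exact this)
    (fun v w w' => by
      have := (exteriorPower.ιMulti ℂ 2 (M := V)).map_update_add ![v, w] 1 w w'
      simp only [update_pair_one] at this
      exact this)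
    (fun c v w => by
      have := (exteriorPower.ιMulti ℂ 2 (M := V)).map_update_smul ![v, w] 1 c w
      simp only [update_pair_one] at this
      exact this)

lemma wedgeₗ_apply (v w : V) : wedgeₗ v w = wedge v w := rfl

lemma wedge_add_left (v v' w : V) : wedge (v + v') w = wedge v w + wedge v' w := by
  simp [← wedgeₗ_apply]

lemma wedge_add_right (v w w' : V) : wedge v (w + w') = wedge v w + wedge v w' := by
  simp [← wedgeₗ_apply]

lemma wedge_smul_left (c : ℂ) (v w : V) : wedge (c • v) w = c • wedge v w := by
  simp [← wedgeₗ_apply]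

lemma wedge_smul_right (c : ℂ) (v w : V) : wedge v (c • w) = c • wedge v w := by
  simp [← wedgeₗ_apply]

@[simp] lemma wedge_self (v : V) : wedge v v = 0 := by
  rw [wedge]
  exact (exteriorPower.ιMulti ℂ 2 (M := V)).map_eq_zero_of_eq _ (i := 0) (j := 1) rfl (by simp)

lemma wedge_swap (v w : V) : wedge w v = - wedge v w := by
  have h : wedge (v + w) (v + w) = 0 := wedge_self _
  rw [wedge_add_left, wedge_add_right, wedge_add_right, wedge_self, wedge_self, zero_add,
    add_zero] at h
  exact eq_neg_of_add_eq_zero_right h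

lemma span_wedge (W : Submodule ℂ V) :
    wedge2Sub W = Submodule.span ℂ {u | ∃ v ∈ W, ∃ w ∈ W, u = wedge v w} := by
  rw [wedge2Sub, LinearMap.range_eq_map, ← exteriorPower.ιMulti_span, Submodule.map_span]
  congr 1
  ext u
  simp only [Set.mem_image, Set.mem_range, exists_exists_eq_and, exteriorPower.map_apply_ιMulti,
    Set.mem_ofPred_eq, wedge]
  constructor
  · rintro ⟨y, rfl⟩
    refine ⟨y 0, (y 0).2, y 1, (y 1).2, ?_⟩
    congr 1
    ext i
    fin_cases i <;> rfl
  · rintro ⟨v, hv, w, hw, rfl⟩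
    refine ⟨![⟨v, hv⟩, ⟨w, hw⟩], ?_⟩
    congr 1
    ext i
    fin_cases i <;> rfl

lemma wedge_mem {W : Submodule ℂ V} {v w : V} (hv : v ∈ W) (hw : w ∈ W) :
    wedge v w ∈ wedge2Sub W := by
  rw [span_wedge]
  exact Submodule.subset_span ⟨v, hv, w, hw, rfl⟩

/-- Every linear form on `∧²V` is a combination of the `p i j`. -/
lemma exists_eq_sum_p (ψ : Wedge2 →ₗ[ℂ] ℂ) :
    ∃ c : Fin 5 × Fin 5 → ℂ, ψ = ∑ r, c r • p r.1 r.2 := by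
  refine ⟨fun r => (1 / 2) * ψ (wedge (Pi.single r.1 1) (Pi.single r.2 1)), wedge2_ext fun v w => ?_⟩
  have hv : ∀ v : V, v = ∑ i, v i • (Pi.single i (1 : ℂ) : V) := fun v => by
    simpa using (pi_eq_sum_univ' v)
  have key : ∀ v w : V, ψ (wedge v w) =
      ∑ i, ∑ j, v i * w j * ψ (wedge (Pi.single i 1) (Pi.single j 1)) := by
    intro v w
    conv_lhs => rw [hv v, hv w]
    simp only [← wedgeₗ_apply, map_sum, LinearMap.sum_apply, map_smul, LinearMap.smul_apply,
      smul_eq_mul, Finset.mul_sum]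
    rw [Finset.sum_comm]
    refine Finset.sum_congr rfl fun i _ => Finset.sum_congr rfl fun j _ => ?_
    ring
  have h2 : ψ (wedge v w) = (1 / 2) * (ψ (wedge v w) - ψ (wedge w v)) := by
    rw [wedge_swap v w, map_neg]; ring
  rw [h2, key v w, key w v, Fintype.sum_prod_type]
  simp only [LinearMap.sum_apply, LinearMap.smul_apply, smul_eq_mul, p_wedge]
  rw [← Finset.sum_sub_distrib, Finset.mul_sum]
  refine Finset.sum_congr rfl fun i _ => ?_
  rw [← Finset.sum_sub_distrib, Finset.mul_sum]
  refine Finset.sum_congr rfl fun j _ => ?_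
  ring

lemma exists_eq_sum_proj (ψ : V →ₗ[ℂ] ℂ) :
    ∃ c : Fin 5 → ℂ, ψ = ∑ r, c r • (LinearMap.proj r : V →ₗ[ℂ] ℂ) := by
  refine ⟨fun r => ψ (Pi.single r 1), ?_⟩
  ext i
  simp [Pi.single_apply]

/-- Minors of linear forms on `V₄` are linear in the Plücker coordinates. -/
lemma exists_poly_V (Φ : Fin 4 → V →ₗ[ℂ] ℂ) :
    ∃ P, IsBihomogeneous P (1, 0) ∧ ∀ (y : SG) (F : Frame y), MvPolynomial.eval F.plucker P =
      Matrix.det (Matrix.of fun k l => Φ l (F.a k : V)) := by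
  choose c hc using fun l => exists_eq_sum_proj (Φ l)
  refine ⟨∑ J : Fin 4 → Fin 5, MvPolynomial.C (∏ l, c l (J l)) * MvPolynomial.X (Sum.inl J), ?_, ?_⟩
  · refine MvPolynomial.IsWeightedHomogeneous.sum _ _ _ fun J _ => ?_
    rw [← zero_add ((1, 0) : ℕ × ℕ)]
    exact (MvPolynomial.isWeightedHomogeneous_C _ _).mul
      (MvPolynomial.isWeightedHomogeneous_X ℂ _ (Sum.inl J))
  · intro y F
    simp only [hc, det_of_sum]
    simp [Frame.plucker]

/-- Minors of linear forms on `U` are linear in the Plücker coordinates. -/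
lemma exists_poly_U (Φ : Fin 3 → Wedge2 →ₗ[ℂ] ℂ) :
    ∃ P, IsBihomogeneous P (0, 1) ∧ ∀ (y : SG) (F : Frame y), MvPolynomial.eval F.plucker P =
      Matrix.det (Matrix.of fun k l => Φ l (F.b k : Wedge2)) := by
  choose c hc using fun l => exists_eq_sum_p (Φ l)
  refine ⟨∑ J : Fin 3 → Fin 5 × Fin 5,
    MvPolynomial.C (∏ l, c l (J l)) * MvPolynomial.X (Sum.inr J), ?_, ?_⟩
  · refine MvPolynomial.IsWeightedHomogeneous.sum _ _ _ fun J _ => ?_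
    rw [← zero_add ((0, 1) : ℕ × ℕ)]
    exact (MvPolynomial.isWeightedHomogeneous_C _ _).mul
      (MvPolynomial.isWeightedHomogeneous_X ℂ _ (Sum.inr J))
  · intro y F
    simp only [hc, det_of_sum]
    simp [Frame.plucker]

/-! ### Regular functions -/

instance free_submodule (U : Submodule ℂ Wedge2) : Module.Free ℂ U :=
  Module.Free.of_divisionRing ℂ U

lemma Frame.nonempty (y : SG) : Nonempty (Frame y) :=
  ⟨⟨Module.finBasisOfFinrankEq ℂ y.V4 y.finrank_V4, Module.finBasisOfFinrankEq ℂ y.U y.finrank_U⟩⟩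

/-- All minors of linear forms change by one common factor under a change of basis. -/
lemma exists_det_scale {M : Type*} [AddCommGroup M] [Module ℂ M] {n : ℕ} {W : Submodule ℂ M}
    (B B' : Module.Basis (Fin n) ℂ W) : ∃ u : ℂ, u ≠ 0 ∧ ∀ Φ : Fin n → M →ₗ[ℂ] ℂ,
      Matrix.det (Matrix.of fun k l => Φ l (B' k : M)) =
        u * Matrix.det (Matrix.of fun k l => Φ l (B k : M)) := by
  refine ⟨(B.toMatrix B').det, fun h => ?_, fun Φ => ?_⟩
  · have h1 := congrArg Matrix.det (B.toMatrix_mul_toMatrix_flip B')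
    rw [Matrix.det_mul, h] at h1
    simp at h1
  · rw [← Matrix.det_transpose (B.toMatrix B'), ← Matrix.det_mul]
    congr 1
    ext k l
    have h2 := congrArg (fun w : W => Φ l (w : M)) (B.sum_repr (B' k))
    simp only [Submodule.coe_sum, Submodule.coe_smul, map_sum, map_smul] at h2
    simp [Matrix.mul_apply, Module.Basis.toMatrix_apply, ← h2]

lemma Frame.exists_scale {y : SG} (F F' : Frame y) : ∃ u v : ℂ, u ≠ 0 ∧ v ≠ 0 ∧
    F'.plucker = fun i => Sum.elim (fun _ => u) (fun _ => v) i * F.plucker i := by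
  obtain ⟨u, hu, hu'⟩ := exists_det_scale F.a F'.a
  obtain ⟨v, hv, hv'⟩ := exists_det_scale F.b F'.b
  refine ⟨u, v, hu, hv, funext fun i => ?_⟩
  rcases i with I | J
  · exact hu' fun l => LinearMap.proj (I l)
  · exact hv' fun l => p (J l).1 (J l).2

lemma IsBihomogeneous.eval_scale {P : MvPolynomial PluckerIndex ℂ} {d : ℕ × ℕ}
    (hP : IsBihomogeneous P d) (u v : ℂ) (f : PluckerIndex → ℂ) :
    MvPolynomial.eval (fun i => Sum.elim (fun _ => u) (fun _ => v) i * f i) P =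
      u ^ d.1 * v ^ d.2 * MvPolynomial.eval f P := by
  rw [MvPolynomial.eval_eq, MvPolynomial.eval_eq, Finset.mul_sum]
  refine Finset.sum_congr rfl fun e he => ?_
  have hd := hP (MvPolynomial.mem_support_iff.mp he)
  have key : ∏ i ∈ e.support, (Sum.elim (fun _ => u) (fun _ => v) i : ℂ) ^ e i =
      u ^ d.1 * v ^ d.2 := by
    rw [← hd, Finsupp.weight_apply, Finsupp.sum, Prod.fst_sum, Prod.snd_sum,
      ← Finset.prod_pow_eq_pow_sum, ← Finset.prod_pow_eq_pow_sum, ← Finset.prod_mul_distrib]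
    refine Finset.prod_congr rfl fun i _ => ?_
    rcases i with i | i <;> simp
  simp only [mul_pow, Finset.prod_mul_distrib]
  rw [key]
  ring

lemma IsBihomogeneous.mem_basicOpen_iff {P : MvPolynomial PluckerIndex ℂ} {d : ℕ × ℕ}
    (hP : IsBihomogeneous P d) {y : SG} (F : Frame y) :
    y ∈ basicOpen P ↔ MvPolynomial.eval F.plucker P ≠ 0 := by
  refine ⟨fun h => h F, fun h F' => ?_⟩
  obtain ⟨u, v, hu, hv, h'⟩ := F.exists_scale F'
  rw [h', hP.eval_scale]
  exact mul_ne_zero (mul_ne_zero (pow_ne_zero _ hu) (pow_ne_zero _ hv)) h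

lemma IsBihomogeneous.eventually {P : MvPolynomial PluckerIndex ℂ} {d : ℕ × ℕ}
    (hP : IsBihomogeneous P d) {x : SG} (hx : x ∈ basicOpen P) : ∀ᶠ y in 𝓝 x, y ∈ basicOpen P :=
  IsOpen.mem_nhds (show IsOpen (basicOpen P) from
    TopologicalSpace.isOpen_generateFrom_of_mem ⟨P, d, hP, rfl⟩) hx

namespace RegularAt

variable {f g : SG → ℂ} {x : SG}

lemma congr (hf : RegularAt f x) (h : f =ᶠ[𝓝 x] g) : RegularAt g x := by
  obtain ⟨d, P, Q, hP, hQ, h1⟩ := hf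
  refine ⟨d, P, Q, hP, hQ, ?_⟩
  filter_upwards [h1, h] with y hy hy'
  rwa [← hy']

lemma neg (hf : RegularAt f x) : RegularAt (-f) x :=
  ((RegularAt.const (-1) x).mul hf).congr (Eventually.of_forall fun y => by simp)

lemma eventually_ne (hf : RegularAt f x) (hx : f x ≠ 0) : ∀ᶠ y in 𝓝 x, f y ≠ 0 := by
  obtain ⟨d, P, Q, hP, hQ, h⟩ := hf
  have h0 := h.self_of_nhds
  have hPx : x ∈ basicOpen P := fun F hF => hx (by rw [(h0 F).2, hF, zero_div])
  filter_upwards [h, hP.eventually hPx] with y hy hPy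
  obtain ⟨F⟩ := Frame.nonempty y
  rw [(hy F).2]
  exact div_ne_zero (hPy F) (hy F).1

lemma inv (hf : RegularAt f x) (hx : f x ≠ 0) : RegularAt f⁻¹ x := by
  obtain ⟨d, P, Q, hP, hQ, h⟩ := hf
  have h0 := h.self_of_nhds
  have hPx : x ∈ basicOpen P := fun F hF => hx (by rw [(h0 F).2, hF, zero_div])
  refine ⟨d, Q, P, hQ, hP, ?_⟩
  filter_upwards [h, hP.eventually hPx] with y hy hPy F
  exact ⟨hPy F, by rw [Pi.inv_apply, (hy F).2, inv_div]⟩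

end RegularAt

/-- Near `x`, a frame of `V₄` at `x` dual to linear forms spreads out to a regular one. -/
lemma exists_regular_dualFrame_V4 {x : SG} {Φ : Fin 4 → V →ₗ[ℂ] ℂ} {b : Fin 4 → V}
    (h : IsDualFrame x.V4 Φ b) : ∃ a : Fin 4 → SG → V,
      (∀ᶠ y in 𝓝 x, IsDualFrame y.V4 Φ fun k => a k y) ∧
      ∀ (ψ : V →ₗ[ℂ] ℂ) k, RegularAt (fun y => ψ (a k y)) x := by
  classical
  obtain ⟨Q, hQ, hQ'⟩ := exists_poly_V Φ
  have hQx : x ∈ basicOpen Q := fun F => by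
    rw [hQ']; exact h.det_ne_zero F.a
  have hex : ∀ y ∈ basicOpen Q, ∃ a, IsDualFrame y.V4 Φ a := fun y hy => by
    obtain ⟨F⟩ := Frame.nonempty y
    exact IsDualFrame.exists_of_det_ne_zero F.a (by rw [← hQ']; exact hy F)
  choose! a ha using hex
  refine ⟨fun k y => a y k, ?_, fun ψ k => ?_⟩
  · filter_upwards [hQ.eventually hQx] with y hy using ha y hy
  · obtain ⟨P, hP, hP'⟩ := exists_poly_V (Function.update Φ k ψ)
    refine ⟨_, P, Q, hP, hQ, ?_⟩
    filter_upwards [hQ.eventually hQx] with y hy F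
    refine ⟨hy F, ?_⟩
    rw [eq_div_iff (hy F), hP', hQ', (ha y hy).apply_mul_det F.a]

/-- Near `x`, a frame of `U` at `x` dual to linear forms spreads out to a regular one. -/
lemma exists_regular_dualFrame_U {x : SG} {Φ : Fin 3 → Wedge2 →ₗ[ℂ] ℂ} {b : Fin 3 → Wedge2}
    (h : IsDualFrame x.U Φ b) : ∃ a : Fin 3 → SG → Wedge2,
      (∀ᶠ y in 𝓝 x, IsDualFrame y.U Φ fun k => a k y) ∧
      ∀ (ψ : Wedge2 →ₗ[ℂ] ℂ) k, RegularAt (fun y => ψ (a k y)) x := by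
  classical
  obtain ⟨Q, hQ, hQ'⟩ := exists_poly_U Φ
  have hQx : x ∈ basicOpen Q := fun F => by
    rw [hQ']; exact h.det_ne_zero F.b
  have hex : ∀ y ∈ basicOpen Q, ∃ a, IsDualFrame y.U Φ a := fun y hy => by
    obtain ⟨F⟩ := Frame.nonempty y
    exact IsDualFrame.exists_of_det_ne_zero F.b (by rw [← hQ']; exact hy F)
  choose! a ha using hex
  refine ⟨fun k y => a y k, ?_, fun ψ k => ?_⟩
  · filter_upwards [hQ.eventually hQx] with y hy using ha y hy
  · obtain ⟨P, hP, hP'⟩ := exists_poly_U (Function.update Φ k ψ)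
    refine ⟨_, P, Q, hP, hQ, ?_⟩
    filter_upwards [hQ.eventually hQx] with y hy F
    refine ⟨hy F, ?_⟩
    rw [eq_div_iff (hy F), hP', hQ', (ha y hy).apply_mul_det F.b]

/-- Functions regular at `x`. -/
def regularFunctions (x : SG) : Subalgebra ℂ (SG → ℂ) where
  carrier := {f | RegularAt f x}
  mul_mem' := RegularAt.mul
  add_mem' := RegularAt.add
  algebraMap_mem' c := RegularAt.const c x

/-- The germ at `x` of a function regular at `x`. -/
def regularFunctions.germ (x : SG) : regularFunctions x →ₐ[ℂ] localRing x where
  toFun f := ⟨((f : SG → ℂ) : Germ (𝓝 x) ℂ), f, f.2, rfl⟩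
  map_one' := rfl
  map_mul' _ _ := rfl
  map_zero' := rfl
  map_add' _ _ := rfl
  commutes' c := ((localRing x).algebraMap_mem c).elim fun _ _ => Subtype.ext <| by
    change _ = algebraMap ℂ (Germ (𝓝 x) ℂ) c
    rw [Algebra.algebraMap_eq_smul_one]
    exact congrArg (Germ.ofFun (l := 𝓝 x)) (funext fun _ => by simp)

lemma regularFunctions.germ_surjective (x : SG) : Function.Surjective (germ x) := by
  rintro ⟨_, f, hf, rfl⟩
  exact ⟨⟨f, hf⟩, rfl⟩

lemma regularFunctions.germ_eq_iff {x : SG} {f g : regularFunctions x} :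
    germ x f = germ x g ↔ ∀ᶠ y in 𝓝 x, (f : SG → ℂ) y = (g : SG → ℂ) y := by
  rw [← Subtype.coe_inj]
  exact Germ.coe_eq

lemma regularFunctions.germ_mem_idealAt {x : SG} {f : regularFunctions x} {Z : Set SG} :
    germ x f ∈ idealAt Z x ↔ ∀ᶠ y in 𝓝 x, y ∈ Z → (f : SG → ℂ) y = 0 := by
  constructor
  · rintro ⟨g, hg, hg'⟩
    filter_upwards [Germ.coe_eq.mp hg, hg'] with y h1 h2 hy
    rw [h1, h2 hy]
  · exact fun h => ⟨f, rfl, h⟩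

lemma idealAt_mono {Z Z' : Set SG} (h : Z ⊆ Z') (x : SG) : idealAt Z' x ≤ idealAt Z x := by
  rintro φ ⟨f, hf, hf'⟩
  exact ⟨f, hf, hf'.mono fun y hy hyZ => hy (h hyZ)⟩

lemma idealAt_eq_top {Z : Set SG} {x : SG} (h : ∀ᶠ y in 𝓝 x, y ∉ Z) : idealAt Z x = ⊤ := by
  rw [Ideal.eq_top_iff_one]
  exact ⟨fun _ => 1, rfl, h.mono fun y hy hyZ => absurd hyZ hy⟩

/-! ### Bivectors in a four-dimensional space -/

/-- The first member of the `i`-th of the six pairs `01, 02, 03, 12, 13, 23`. -/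
def pairFst : Fin 6 → Fin 4 := ![0, 0, 0, 1, 1, 2]

/-- The second member of the `i`-th of the six pairs `01, 02, 03, 12, 13, 23`. -/
def pairSnd : Fin 6 → Fin 4 := ![1, 2, 3, 2, 3, 3]

/-- The bivector with coordinates `c` with respect to the wedges of pairs of the vectors `a`. -/
noncomputable def bivector (a : Fin 4 → V) (c : Fin 6 → ℂ) : Wedge2 :=
  ∑ i, c i • wedge (a (pairFst i)) (a (pairSnd i))

lemma bivector_eq (a : Fin 4 → V) (c : Fin 6 → ℂ) : bivector a c =
    c 0 • wedge (a 0) (a 1) + c 1 • wedge (a 0) (a 2) + c 2 • wedge (a 0) (a 3) +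
      c 3 • wedge (a 1) (a 2) + c 4 • wedge (a 1) (a 3) + c 5 • wedge (a 2) (a 3) := by
  simp [bivector, Fin.sum_univ_six, pairFst, pairSnd]

lemma bivector_mem {W : Submodule ℂ V} {a : Fin 4 → V} (ha : ∀ k, a k ∈ W) (c : Fin 6 → ℂ) :
    bivector a c ∈ wedge2Sub W :=
  Submodule.sum_mem _ fun _ _ => Submodule.smul_mem _ _ (wedge_mem (ha _) (ha _))

lemma bivector_sum {n : ℕ} (a : Fin 4 → V) (c : Fin n → Fin 6 → ℂ) (r : Fin n → ℂ) :
    ∑ k, r k • bivector a (c k) = bivector a (fun i => ∑ k, r k * c k i) := by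
  simp only [bivector, Finset.smul_sum, Finset.sum_smul, smul_smul]
  exact Finset.sum_comm

/-- The coordinate of a bivector at the `i`-th pair of the first four basis vectors. -/
noncomputable def pairCoord (E : Module.Basis (Fin 5) ℂ V) (i : Fin 6) : Wedge2 →ₗ[ℂ] ℂ :=
  pairForm (E.coord (pairFst i).castSucc) (E.coord (pairSnd i).castSucc)

lemma pairCoord_bivector {E : Module.Basis (Fin 5) ℂ V} {a : Fin 4 → V}
    (ha : ∀ k l : Fin 4, E.coord l.castSucc (a k) = if k = l then 1 else 0) (c : Fin 6 → ℂ)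
    (i : Fin 6) : pairCoord E i (bivector a c) = c i := by
  simp only [bivector, map_sum, map_smul, pairCoord, pairForm_wedge, ha]
  fin_cases i <;> simp [Fin.sum_univ_six, pairFst, pairSnd]

lemma wedge_sum (a : Fin 4 → V) (p q : Fin 4 → ℂ) :
    wedge (∑ k, p k • a k) (∑ k, q k • a k) =
      bivector a fun i => p (pairFst i) * q (pairSnd i) - p (pairSnd i) * q (pairFst i) := by
  simp only [bivector_eq, Fin.sum_univ_four, wedge_add_left, wedge_add_right, wedge_smul_left,
    wedge_smul_right, wedge_self]
  rw [wedge_swap (a 0) (a 1), wedge_swap (a 0) (a 2), wedge_swap (a 0) (a 3),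
    wedge_swap (a 1) (a 2), wedge_swap (a 1) (a 3), wedge_swap (a 2) (a 3)]
  simp only [pairFst, pairSnd, Matrix.cons_val]
  module

lemma eq_bivector {E : Module.Basis (Fin 5) ℂ V} {W : Submodule ℂ V} {a : Fin 4 → V}
    (ha : IsDualFrame W (fun l => E.coord l.castSucc) a) (hW : Module.finrank ℂ W = 4)
    {u : Wedge2} (hu : u ∈ wedge2Sub W) : u = bivector a (fun i => pairCoord E i u) := by
  rw [span_wedge] at hu
  induction hu using Submodule.span_induction with
  | mem u hu =>
    obtain ⟨v, hv, w, hw, rfl⟩ := hu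
    conv_lhs => rw [ha.eq_sum hW hv, ha.eq_sum hW hw, wedge_sum]
    simp only [pairCoord, pairForm_wedge]
  | zero => simp [bivector]
  | add u u' _ _ h h' =>
    conv_lhs => rw [h, h']
    simp [bivector, add_smul, Finset.sum_add_distrib]
  | smul r u _ h =>
    conv_lhs => rw [h]
    simp [bivector, Finset.smul_sum, smul_smul]

/-- The Plücker quadric: `quad c` is half of the coefficient of `u ∧ u` for the bivector `u` with
coordinates `c`. -/
def quad {R : Type*} [CommRing R] (c : Fin 6 → R) : R := c 0 * c 5 - c 1 * c 4 + c 2 * c 3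

/-- The polar form of the Plücker quadric. -/
def quadPolar {R : Type*} [CommRing R] (c c' : Fin 6 → R) : R :=
  c 0 * c' 5 + c' 0 * c 5 - (c 1 * c' 4 + c' 1 * c 4) + (c 2 * c' 3 + c' 2 * c 3)

lemma quad_pairCoord_wedge (E : Module.Basis (Fin 5) ℂ V) (v w : V) :
    quad (fun i => pairCoord E i (wedge v w)) = 0 := by
  simp only [quad, pairCoord, pairForm_wedge, pairFst, pairSnd, Matrix.cons_val]
  ring

/-- The contractions of a bivector with coordinates `c` with the four coordinate forms. -/
def contraction (c : Fin 6 → ℂ) : Fin 4 → Fin 4 → ℂ :=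
  ![![0, c 0, c 1, c 2], ![-c 0, 0, c 3, c 4], ![-c 1, -c 3, 0, c 5], ![-c 2, -c 4, -c 5, 0]]

/-- A bivector of a four-dimensional space is decomposable if it lies on the Plücker quadric:
`c_ij u = (φ_i ⌟ u) ∧ (φ_j ⌟ u)` for the contractions of `u` with two coordinate forms. -/
lemma exists_wedge_of_quad_eq_zero {W : Submodule ℂ V} {a : Fin 4 → V} (ha : ∀ k, a k ∈ W)
    {c : Fin 6 → ℂ} (hc : quad c = 0) : ∃ v ∈ W, ∃ w ∈ W, bivector a c = wedge v w := by
  have hW : ∀ q : Fin 4 → ℂ, ∑ k, q k • a k ∈ W := fun q =>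
    W.sum_mem fun k _ => W.smul_mem _ (ha k)
  by_cases h : c = 0
  · exact ⟨0, W.zero_mem, 0, W.zero_mem, by simp [h, bivector]⟩
  obtain ⟨i, hi⟩ := Function.ne_iff.mp h
  refine ⟨(c i)⁻¹ • ∑ k, contraction c (pairFst i) k • a k, W.smul_mem _ (hW _),
    ∑ k, contraction c (pairSnd i) k • a k, hW _, ?_⟩
  rw [wedge_smul_left, wedge_sum, eq_inv_smul_iff₀ hi, bivector, Finset.smul_sum, bivector]
  refine Finset.sum_congr rfl fun j _ => ?_
  rw [smul_smul]
  congr 1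
  rw [quad] at hc
  fin_cases i <;> fin_cases j <;>
    simp only [contraction, pairFst, pairSnd, Fin.mk_one, Fin.zero_eta, Fin.reduceFinMk,
      Matrix.cons_val] <;>
    first | ring1 | linear_combination hc | linear_combination -hc

/-! ### Charts of `S(G)` -/

/-- The frame `E_k + t_k E_4` (`k < 4`) of a hyperplane that does not contain `E_4`. The vector `E_4`
is written `E (Fin.last 4)`, so that the frame is dual to the coordinates `E.coord k.castSucc`. -/
noncomputable def hyperplaneFrame (E : Module.Basis (Fin 5) ℂ V) (t : Fin 4 → ℂ) (k : Fin 4) : V :=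
  E k.castSucc + t k • E (Fin.last 4)

/-- The point `y` has coordinates `t`, `c` in the chart attached to a basis `E` of `V` and to three
of the six pairs of indices: `V₄` is spanned by the vectors `a_k = E_k + t_k E_4` and `U` by the
bivectors with coordinates `c k` with respect to the `a_i ∧ a_j`, where `c` restricts to the
identity matrix at the three pairs. -/
structure IsChartPoint (E : Module.Basis (Fin 5) ℂ V) (J : Fin 3 → Fin 6) (y : SG) (t : Fin 4 → ℂ)
    (c : Fin 3 → Fin 6 → ℂ) : Prop where
  mem_V4 : ∀ k, hyperplaneFrame E t k ∈ y.V4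
  mem_U : ∀ k, bivector (hyperplaneFrame E t) (c k) ∈ y.U
  normalized : ∀ k l, c k (J l) = if k = l then 1 else 0

section Charts

variable {E : Module.Basis (Fin 5) ℂ V} {J : Fin 3 → Fin 6}

lemma coord_hyperplaneFrame (t : Fin 4 → ℂ) (k l : Fin 4) :
    E.coord l.castSucc (hyperplaneFrame E t k) = if k = l then 1 else 0 := by
  have h : Fin.last 4 ≠ l.castSucc := (Fin.castSucc_lt_last l).ne'
  simp only [hyperplaneFrame, map_add, map_smul, Module.Basis.coord_apply,
    Module.Basis.repr_self, Finsupp.single_apply, h, if_false, smul_zero, add_zero]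
  simp

lemma coord_last_hyperplaneFrame (t : Fin 4 → ℂ) (k : Fin 4) :
    E.coord (Fin.last 4) (hyperplaneFrame E t k) = t k := by
  have h : k.castSucc ≠ Fin.last 4 := (Fin.castSucc_lt_last k).ne
  simp only [hyperplaneFrame, map_add, map_smul, Module.Basis.coord_apply,
    Module.Basis.repr_self, Finsupp.single_apply, h, if_false, if_true, zero_add]
  simp

lemma eq_hyperplaneFrame {a : Fin 4 → V}
    (ha : ∀ k l : Fin 4, E.coord l.castSucc (a k) = if k = l then 1 else 0) :
    a = hyperplaneFrame E (fun k => E.coord (Fin.last 4) (a k)) := by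
  funext k
  refine E.ext_elem fun i => ?_
  refine Fin.lastCases ?_ (fun l => ?_) i
  · exact (coord_last_hyperplaneFrame (E := E) (fun k => E.coord (Fin.last 4) (a k)) k).symm
  · exact (ha k l).trans (coord_hyperplaneFrame (E := E) _ k l).symm

namespace IsChartPoint

variable {y : SG} {t : Fin 4 → ℂ} {c : Fin 3 → Fin 6 → ℂ}

lemma dual_V4 (h : IsChartPoint E J y t c) :
    IsDualFrame y.V4 (fun l => E.coord l.castSucc) (hyperplaneFrame E t) :=
  ⟨h.mem_V4, fun k l => coord_hyperplaneFrame t k l⟩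

lemma dual_U (h : IsChartPoint E J y t c) :
    IsDualFrame y.U (fun l => pairCoord E (J l))
      (fun k => bivector (hyperplaneFrame E t) (c k)) :=
  ⟨h.mem_U, fun k l => by rw [pairCoord_bivector (coord_hyperplaneFrame t), h.normalized]⟩

lemma unique {t' : Fin 4 → ℂ} {c' : Fin 3 → Fin 6 → ℂ} (h : IsChartPoint E J y t c)
    (h' : IsChartPoint E J y t' c') : t = t' ∧ c = c' := by
  have h1 : t = t' := funext fun k => by
    rw [← coord_last_hyperplaneFrame (E := E) t k, h.dual_V4.unique h'.dual_V4 y.finrank_V4,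
      coord_last_hyperplaneFrame]
  refine ⟨h1, funext fun k => funext fun i => ?_⟩
  rw [← pairCoord_bivector (coord_hyperplaneFrame (E := E) t) (c k),
    congrFun (h.dual_U.unique h'.dual_U y.finrank_U) k,
    pairCoord_bivector (coord_hyperplaneFrame t')]

lemma exists_frame (h : IsChartPoint E J y t c) : ∃ F : Frame y,
    (∀ k, (F.a k : V) = hyperplaneFrame E t k) ∧
      ∀ k, (F.b k : Wedge2) = bivector (hyperplaneFrame E t) (c k) := by
  obtain ⟨A, hA⟩ := h.dual_V4.exists_basis y.finrank_V4
  obtain ⟨B, hB⟩ := h.dual_U.exists_basis y.finrank_U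
  exact ⟨⟨A, B⟩, hA, hB⟩

lemma mem_U_iff (h : IsChartPoint E J y t c) {u : Wedge2} :
    u ∈ y.U ↔ ∃ r : Fin 3 → ℂ, u = bivector (hyperplaneFrame E t) (fun i => ∑ k, r k * c k i) := by
  constructor
  · intro hu
    exact ⟨_, (h.dual_U.eq_sum y.finrank_U hu).trans (bivector_sum _ _ _)⟩
  · rintro ⟨r, rfl⟩
    rw [← bivector_sum]
    exact Submodule.sum_mem _ fun k _ => Submodule.smul_mem _ _ (h.mem_U k)

end IsChartPoint

lemma finrank_span_of_dual {M : Type*} [AddCommGroup M] [Module ℂ M] {n : ℕ}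
    {Φ : Fin n → M →ₗ[ℂ] ℂ} {b : Fin n → M} (h : ∀ k l, Φ l (b k) = if k = l then 1 else 0) :
    Module.finrank ℂ (Submodule.span ℂ (Set.range b)) = n := by
  have hli : LinearIndependent ℂ b := by
    rw [Fintype.linearIndependent_iff]
    intro g hg i
    have h1 := congrArg (Φ i) hg
    simpa [h] using h1
  rw [finrank_span_eq_card hli, Fintype.card_fin]

lemma exists_isChartPoint (E : Module.Basis (Fin 5) ℂ V) {J : Fin 3 → Fin 6} (t : Fin 4 → ℂ)
    {c : Fin 3 → Fin 6 → ℂ} (hc : ∀ k l, c k (J l) = if k = l then 1 else 0) :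
    ∃ y : SG, IsChartPoint E J y t c := by
  refine ⟨⟨Submodule.span ℂ (Set.range (hyperplaneFrame E t)),
    Submodule.span ℂ (Set.range fun k => bivector (hyperplaneFrame E t) (c k)),
    finrank_span_of_dual fun k l => coord_hyperplaneFrame (E := E) t k l,
    finrank_span_of_dual (Φ := fun l => pairCoord E (J l)) fun k l => by
      rw [pairCoord_bivector (coord_hyperplaneFrame t), hc], ?_⟩, ?_, ?_, hc⟩
  · rw [Submodule.span_le]
    rintro _ ⟨k, rfl⟩
    exact bivector_mem (fun k => Submodule.subset_span (Set.mem_range_self k)) _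
  · exact fun k => Submodule.subset_span (Set.mem_range_self k)
  · exact fun k => Submodule.subset_span (Set.mem_range_self k)

/-- The chart coordinates are regular functions. -/
lemma IsChartPoint.exists_regular {x : SG} {t₀ : Fin 4 → ℂ} {c₀ : Fin 3 → Fin 6 → ℂ}
    (h : IsChartPoint E J x t₀ c₀) :
    ∃ (t : Fin 4 → regularFunctions x) (c : Fin 3 → Fin 6 → regularFunctions x),
      ∀ᶠ y in 𝓝 x, IsChartPoint E J y (fun k => (t k : SG → ℂ) y)
        fun k i => (c k i : SG → ℂ) y := by
  obtain ⟨a, ha, ha'⟩ := exists_regular_dualFrame_V4 h.dual_V4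
  obtain ⟨b, hb, hb'⟩ := exists_regular_dualFrame_U h.dual_U
  refine ⟨fun k => ⟨_, ha' (E.coord (Fin.last 4)) k⟩, fun k i => ⟨_, hb' (pairCoord E i) k⟩, ?_⟩
  filter_upwards [ha, hb] with y hy hy'
  have h1 := eq_hyperplaneFrame hy.dual
  have h2 : ∀ k, b k y = bivector (fun k => a k y) (fun i => pairCoord E i (b k y)) := fun k =>
    eq_bivector hy y.finrank_V4 (y.U_le (hy'.mem k))
  refine ⟨fun k => ?_, fun k => ?_, fun k l => hy'.dual k l⟩
  · rw [← h1]; exact hy.mem k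
  · rw [← h1, ← h2]; exact hy'.mem k

/-! ### Equations of `T(G)` and `S(Y_m)` in a chart -/

/-- The equations of `T(G)` in a chart: `U` is isotropic for the Plücker quadric. -/
def IsIsotropic {R : Type*} [CommRing R] (c : Fin 3 → Fin 6 → R) : Prop :=
  (∀ k, quad (c k) = 0) ∧ ∀ k l, quadPolar (c k) (c l) = 0

/-- The two linear forms `φ₁ ∧ φ₂ - φ₀ ∧ φ₄` and `φ₁ ∧ φ₄ - φ₂ ∧ φ₃` on `∧²V`, where `φ` is the basis
dual to `E`. -/
noncomputable def standardForm (E : Module.Basis (Fin 5) ℂ V) : Fin 2 → (Wedge2 →ₗ[ℂ] ℂ) :=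
  ![pairForm (E.coord 1) (E.coord 2) - pairForm (E.coord 0) (E.coord 4),
    pairForm (E.coord 1) (E.coord 4) - pairForm (E.coord 2) (E.coord 3)]

/-- The value of the standard linear forms in a chart. -/
def standardEq {R : Type*} [CommRing R] (t : Fin 4 → R) (c : Fin 6 → R) : Fin 2 → R :=
  ![c 3 - (c 0 * t 1 + c 1 * t 2 + c 2 * t 3), c 3 * t 2 + c 4 * t 3 - c 0 * t 0 - c 5]

lemma standardForm_bivector (t : Fin 4 → ℂ) (c : Fin 6 → ℂ) (i : Fin 2) :
    standardForm E i (bivector (hyperplaneFrame E t) c) = standardEq t c i := by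
  have h0 := fun k => coord_hyperplaneFrame (E := E) t k 0
  have h1 := fun k => coord_hyperplaneFrame (E := E) t k 1
  have h2 := fun k => coord_hyperplaneFrame (E := E) t k 2
  have h3 := fun k => coord_hyperplaneFrame (E := E) t k 3
  have h4 := fun k => coord_last_hyperplaneFrame (E := E) t k
  simp only [show (0 : Fin 4).castSucc = (0 : Fin 5) from rfl,
    show (1 : Fin 4).castSucc = (1 : Fin 5) from rfl,
    show (2 : Fin 4).castSucc = (2 : Fin 5) from rfl,
    show (3 : Fin 4).castSucc = (3 : Fin 5) from rfl,
    show Fin.last 4 = (4 : Fin 5) from rfl] at h0 h1 h2 h3 h4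
  simp only [standardForm, standardEq, bivector_eq]
  fin_cases i <;>
  · simp [pairForm_wedge, -Module.Basis.coord_apply, h0, h1, h2, h3, h4]
    try ring

/-- The basis `E` puts the linear forms that define `Y_m` into standard form. -/
def IsAdapted (m : ℕ) (E : Module.Basis (Fin 5) ℂ V) : Prop :=
  ∀ u, (∀ i : Fin 2, (i : ℕ) + m < 6 → hyperplane i u = 0) ↔
    ∀ i : Fin 2, (i : ℕ) + m < 6 → standardForm E i u = 0

lemma mem_SY_iff {m : ℕ} {y : SG} : y ∈ SY m ↔
    ∀ u ∈ y.U, ∀ i : Fin 2, (i : ℕ) + m < 6 → hyperplane i u = 0 := by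
  simp only [SY, Set.mem_ofPred_eq, K]
  constructor
  · intro h u hu
    simpa using (h hu).2
  · intro h u hu
    exact ⟨y.U_le hu, by simpa using h u hu⟩

lemma IsChartPoint.mem_SY_iff {m : ℕ} {y : SG} {t : Fin 4 → ℂ} {c : Fin 3 → Fin 6 → ℂ}
    (hE : IsAdapted m E) (h : IsChartPoint E J y t c) :
    y ∈ SY m ↔ ∀ (i : Fin 2) k, (i : ℕ) + m < 6 → standardEq t (c k) i = 0 := by
  rw [QuinticDelPezzo.mem_SY_iff]
  constructor
  · intro hy i k hi
    rw [← standardForm_bivector (E := E)]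
    exact (hE _).mp (hy _ (h.mem_U k)) i hi
  · intro hy u hu
    refine (hE u).mpr fun i hi => ?_
    rw [h.dual_U.eq_sum y.finrank_U hu]
    simp only [map_sum, map_smul, standardForm_bivector, hy i _ hi, smul_zero,
      Finset.sum_const_zero]

lemma quad_add {R : Type*} [CommRing R] (c c' : Fin 6 → R) :
    quad (c + c') = quad c + quad c' + quadPolar c c' := by
  simp only [quad, quadPolar, Pi.add_apply]; ring

lemma IsChartPoint.mem_TG_iff {y : SG} {t : Fin 4 → ℂ} {c : Fin 3 → Fin 6 → ℂ}
    (h : IsChartPoint E J y t c) : y ∈ TG ↔ IsIsotropic c := by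
  constructor
  · intro hy
    have h1 : ∀ c', bivector (hyperplaneFrame E t) c' ∈ y.U → quad c' = 0 := by
      intro c' hc'
      obtain ⟨v, -, w, -, h2⟩ := hy _ hc'
      rw [← quad_pairCoord_wedge E v w, ← h2]
      simp only [pairCoord_bivector (coord_hyperplaneFrame t)]
    refine ⟨fun k => h1 _ (h.mem_U k), fun k l => ?_⟩
    have h2 := h1 (c k + c l) (by
      have : bivector (hyperplaneFrame E t) (c k + c l) =
          bivector (hyperplaneFrame E t) (c k) + bivector (hyperplaneFrame E t) (c l) := by
        simp [bivector, add_smul, Finset.sum_add_distrib]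
      rw [this]
      exact y.U.add_mem (h.mem_U k) (h.mem_U l))
    rwa [quad_add, h1 _ (h.mem_U k), h1 _ (h.mem_U l), zero_add, zero_add] at h2
  · rintro ⟨hc, hc'⟩ u hu
    obtain ⟨r, rfl⟩ := h.mem_U_iff.mp hu
    refine exists_wedge_of_quad_eq_zero h.mem_V4 ?_
    have := hc 0; have := hc 1; have := hc 2
    have := hc' 0 1; have := hc' 0 2; have := hc' 1 2
    simp only [quad, quadPolar, Fin.sum_univ_three] at *
    linear_combination (r 0) ^ 2 * hc 0 + (r 1) ^ 2 * hc 1 + (r 2) ^ 2 * hc 2 +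
      r 0 * r 1 * hc' 0 1 + r 0 * r 2 * hc' 0 2 + r 1 * r 2 * hc' 1 2

end Charts

/-! ### Plücker coordinates in a chart -/

/-- The Plücker coordinates of the point with chart coordinates `t`, `c`, over any `ℂ`-algebra. -/
noncomputable def chartPlucker (E : Module.Basis (Fin 5) ℂ V) {R : Type*} [CommRing R] [Algebra ℂ R]
    (t : Fin 4 → R) (c : Fin 3 → Fin 6 → R) : PluckerIndex → R :=
  let a : Fin 4 → Fin 5 → R := fun k r =>
    algebraMap ℂ R (E k.castSucc r) + t k * algebraMap ℂ R (E (Fin.last 4) r)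
  Sum.elim (fun I => Matrix.det (Matrix.of fun k l => a k (I l)))
    (fun K => Matrix.det (Matrix.of fun k l => ∑ i, c k i *
      (a (pairFst i) (K l).1 * a (pairSnd i) (K l).2 -
        a (pairFst i) (K l).2 * a (pairSnd i) (K l).1)))

lemma map_chartPlucker (E : Module.Basis (Fin 5) ℂ V) {R S : Type*} [CommRing R] [Algebra ℂ R]
    [CommRing S] [Algebra ℂ S] (f : R →ₐ[ℂ] S) (t : Fin 4 → R) (c : Fin 3 → Fin 6 → R)
    (i : PluckerIndex) : f (chartPlucker E t c i) =
      chartPlucker E (fun k => f (t k)) (fun k i => f (c k i)) i := by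
  rcases i with I | K <;>
  · simp only [chartPlucker, Sum.elim_inl, Sum.elim_inr, AlgHom.map_det]
    congr 1
    ext k l
    simp

lemma plucker_eq_chartPlucker {E : Module.Basis (Fin 5) ℂ V} {y : SG} {t : Fin 4 → ℂ}
    {c : Fin 3 → Fin 6 → ℂ} {F : Frame y} (ha : ∀ k, (F.a k : V) = hyperplaneFrame E t k)
    (hb : ∀ k, (F.b k : Wedge2) = bivector (hyperplaneFrame E t) (c k)) :
    F.plucker = chartPlucker E t c := by
  funext i
  rcases i with I | K
  · simp only [Frame.plucker, chartPlucker, ha, hyperplaneFrame, Sum.elim_inl]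
    rfl
  · simp only [Frame.plucker, chartPlucker, hb, bivector, map_sum, map_smul, p_wedge, Sum.elim_inr]
    congr 1

/-! ### Local parametrizations -/

/-- The equations of `T(Y_m)` in a chart. -/
structure IsSolution (m : ℕ) (J : Fin 3 → Fin 6) {R : Type*} [CommRing R] (t : Fin 4 → R)
    (c : Fin 3 → Fin 6 → R) : Prop where
  normalized : ∀ k l, c k (J l) = if k = l then 1 else 0
  isotropic : IsIsotropic c
  linear : ∀ (i : Fin 2) k, (i : ℕ) + m < 6 → standardEq t (c k) i = 0

section Map

variable {R S F : Type*} [CommRing R] [CommRing S] [FunLike F R S] [RingHomClass F R S] (f : F)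

lemma map_quad (c : Fin 6 → R) : f (quad c) = quad fun i => f (c i) := by
  simp [quad]

lemma map_quadPolar (c c' : Fin 6 → R) :
    f (quadPolar c c') = quadPolar (fun i => f (c i)) fun i => f (c' i) := by
  simp [quadPolar]

lemma map_standardEq (t : Fin 4 → R) (c : Fin 6 → R) (i : Fin 2) :
    f (standardEq t c i) = standardEq (fun k => f (t k)) (fun i => f (c i)) i := by
  fin_cases i <;> simp [standardEq]

lemma IsSolution.map {m : ℕ} {J : Fin 3 → Fin 6} {t : Fin 4 → R} {c : Fin 3 → Fin 6 → R}
    (h : IsSolution m J t c) : IsSolution m J (fun k => f (t k)) fun k i => f (c k i) where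
  normalized k l := by rw [h.normalized]; split_ifs <;> simp
  isotropic := ⟨fun k => by rw [← map_quad, h.isotropic.1, map_zero],
    fun k l => by rw [← map_quadPolar, h.isotropic.2, map_zero]⟩
  linear i k hi := by rw [← map_standardEq, h.linear i k hi, map_zero]

end Map

/-- A polynomial parametrization, by some of the chart coordinates, of all solutions of the
equations of `T(Y_m)` in a chart, over all `ℂ`-algebras. The parameter `0` is the origin of the chart:
the point with `t = 0` where `c` vanishes away from the three chosen pairs. -/
structure Parametrization (m : ℕ) (J : Fin 3 → Fin 6) (d : ℕ) where
  t : Fin 4 → MvPolynomial (Fin d) ℂ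
  c : Fin 3 → Fin 6 → MvPolynomial (Fin d) ℂ
  isSolution : IsSolution m J t c
  /-- The chart coordinates that serve as parameters. -/
  free : Fin d → Fin 4 ⊕ Fin 3 × Fin 6
  free_eq : ∀ j, Sum.elim t (fun q => c q.1 q.2) (free j) = MvPolynomial.X j
  t_zero : ∀ k, MvPolynomial.eval 0 (t k) = 0
  c_zero : ∀ k i, MvPolynomial.eval 0 (c k i) = if i = J k then 1 else 0
  solve : ∀ {R : Type} [CommRing R] [Algebra ℂ R] (s : Fin 4 → R) (e : Fin 3 → Fin 6 → R),
    IsSolution m J s e →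
      (∀ k, s k = MvPolynomial.aeval (fun j => Sum.elim s (fun q => e q.1 q.2) (free j)) (t k)) ∧
      ∀ k i, e k i = MvPolynomial.aeval (fun j => Sum.elim s (fun q => e q.1 q.2) (free j)) (c k i)

lemma IsChartPoint.mem_TY_iff {E : Module.Basis (Fin 5) ℂ V} {J : Fin 3 → Fin 6} {m : ℕ} {y : SG}
    {t : Fin 4 → ℂ} {c : Fin 3 → Fin 6 → ℂ} (hE : IsAdapted m E) (h : IsChartPoint E J y t c) :
    y ∈ TY m ↔ IsSolution m J t c := by
  rw [TY, Set.mem_inter_iff, h.mem_SY_iff hE, h.mem_TG_iff]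
  exact ⟨fun h' => ⟨h.normalized, h'.2, h'.1⟩, fun h' => ⟨h'.3, h'.2⟩⟩

lemma IsChartPoint.point_unique {E : Module.Basis (Fin 5) ℂ V} {J : Fin 3 → Fin 6} {y y' : SG}
    {t : Fin 4 → ℂ} {c : Fin 3 → Fin 6 → ℂ} (h : IsChartPoint E J y t c)
    (h' : IsChartPoint E J y' t c) : y = y' := by
  refine SG.ext ?_ ?_
  · refine le_antisymm (fun v hv => ?_) fun v hv => ?_
    · rw [h.dual_V4.eq_sum y.finrank_V4 hv]
      exact Submodule.sum_mem _ fun k _ => Submodule.smul_mem _ _ (h'.mem_V4 k)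
    · rw [h'.dual_V4.eq_sum y'.finrank_V4 hv]
      exact Submodule.sum_mem _ fun k _ => Submodule.smul_mem _ _ (h.mem_V4 k)
  · ext u
    rw [h.mem_U_iff, h'.mem_U_iff]

/-- A family of points with polynomial chart coordinates is continuous for the Zariski topology. -/
lemma exists_poly_of_mem_nhds {E : Module.Basis (Fin 5) ℂ V} {J : Fin 3 → Fin 6} {d : ℕ}
    {t : Fin 4 → MvPolynomial (Fin d) ℂ} {c : Fin 3 → Fin 6 → MvPolynomial (Fin d) ℂ}
    {y : (Fin d → ℂ) → SG} (hy : ∀ z, IsChartPoint E J (y z) (fun k => MvPolynomial.eval z (t k))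
      fun k i => MvPolynomial.eval z (c k i)) {z₀ : Fin d → ℂ} {S : Set SG} (hS : S ∈ 𝓝 (y z₀)) :
    ∃ Q : MvPolynomial (Fin d) ℂ, MvPolynomial.eval z₀ Q ≠ 0 ∧
      ∀ z, MvPolynomial.eval z Q ≠ 0 → y z ∈ S := by
  obtain ⟨S', hS', hS'o, hz₀⟩ := mem_nhds_iff.mp hS
  suffices h : ∃ Q : MvPolynomial (Fin d) ℂ, MvPolynomial.eval z₀ Q ≠ 0 ∧
      ∀ z, MvPolynomial.eval z Q ≠ 0 → y z ∈ S' from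
    h.imp fun Q hQ => ⟨hQ.1, fun z hz => hS' (hQ.2 z hz)⟩
  clear hS' hS
  change TopologicalSpace.GenerateOpen _ S' at hS'o
  induction hS'o with
  | basic s hs =>
    obtain ⟨P, e, hP, rfl⟩ := hs
    have key : ∀ z, y z ∈ basicOpen P ↔
        MvPolynomial.eval z (MvPolynomial.aeval (chartPlucker E t c) P) ≠ 0 := by
      intro z
      obtain ⟨F, hF, hF'⟩ := (hy z).exists_frame
      rw [hP.mem_basicOpen_iff F, plucker_eq_chartPlucker hF hF']
      have h1 : chartPlucker E (fun k => MvPolynomial.eval z (t k))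
          (fun k i => MvPolynomial.eval z (c k i)) =
          fun i => MvPolynomial.aeval z (chartPlucker E t c i) := by
        funext i
        rw [map_chartPlucker]
        rfl
      rw [h1, ← MvPolynomial.coe_aeval_eq_eval, ← MvPolynomial.coe_aeval_eq_eval,
        RingHom.coe_coe, RingHom.coe_coe, MvPolynomial.comp_aeval_apply]
    exact ⟨_, (key z₀).mp hz₀, fun z hz => (key z).mpr hz⟩
  | univ => exact ⟨1, by simp, fun _ _ => trivial⟩
  | inter s s' _ _ h h' =>
    obtain ⟨Q, hQ, hQ'⟩ := h hz₀.1
    obtain ⟨R, hR, hR'⟩ := h' hz₀.2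
    refine ⟨Q * R, by rw [map_mul]; exact mul_ne_zero hQ hR, fun z hz => ?_⟩
    rw [map_mul] at hz
    exact ⟨hQ' z (left_ne_zero_of_mul hz), hR' z (right_ne_zero_of_mul hz)⟩
  | sUnion s _ h =>
    obtain ⟨s', hs', hz⟩ := hz₀
    obtain ⟨Q, hQ, hQ'⟩ := h s' hs' hz
    exact ⟨Q, hQ, fun z hz => ⟨s', hs', hQ' z hz⟩⟩

/-- Evaluation of regular functions at a point. -/
def regularFunctions.eval (x y : SG) : regularFunctions x →ₐ[ℂ] ℂ :=
  (Pi.evalAlgHom ℂ (fun _ : SG => ℂ) y).comp (regularFunctions x).val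

lemma regularFunctions.aeval_apply {x : SG} {σ : Type*} (f : σ → regularFunctions x)
    (P : MvPolynomial σ ℂ) (y : SG) : (MvPolynomial.aeval f P : SG → ℂ) y =
      MvPolynomial.eval (fun j => (f j : SG → ℂ) y) P := by
  change regularFunctions.eval x y (MvPolynomial.aeval f P) = _
  rw [MvPolynomial.comp_aeval_apply, ← MvPolynomial.coe_aeval_eq_eval]
  rfl

/-! ### The local ring of `T(Y_m)` in a parametrized chart -/

open regularFunctions in
/-- The local ring of `S(G)` modulo `I_{T(G)} + I_{S(Y_m)}` is the local ring of an affine space at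
the origin, and `I_{T(G)} + I_{S(Y_m)}` consists of all germs that vanish on `T(Y_m)`. The quotient
of the local ring enters only through a surjection `q` from the ring of regular functions onto a
`ℂ`-algebra `B`, so that no computation has to unfold germs. -/
theorem Parametrization.local_structure_aux {m d : ℕ} {J : Fin 3 → Fin 6}
    (S : Parametrization m J d) {E : Module.Basis (Fin 5) ℂ V} (hE : IsAdapted m E) {x : SG}
    (hx : IsChartPoint E J x (fun _ => 0) fun k i => if i = J k then 1 else 0)
    {I : Ideal (localRing x)} (hI : I = idealAt TG x ⊔ idealAt (SY m) x)
    {B : Type} [CommRing B] [Algebra ℂ B] (q : regularFunctions x →ₐ[ℂ] B)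
    (hqs : Function.Surjective q) (hq0 : ∀ f, q f = 0 ↔ germ x f ∈ I) :
    idealAt (TY m) x = I ∧ Algebra.FormallySmooth ℂ B := by
  obtain ⟨t, c, htc⟩ := hx.exists_regular
  have hITY : I ≤ idealAt (TY m) x := hI ▸
    sup_le (idealAt_mono Set.inter_subset_right x) (idealAt_mono Set.inter_subset_left x)
  have hqTG : ∀ f : regularFunctions x, (∀ᶠ y in 𝓝 x, y ∈ TG → (f : SG → ℂ) y = 0) → q f = 0 :=
    fun f hf => (hq0 f).mpr (hI ▸ Ideal.mem_sup_left (germ_mem_idealAt.mpr hf))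
  have hqSY : ∀ f : regularFunctions x, (∀ᶠ y in 𝓝 x, y ∈ SY m → (f : SG → ℂ) y = 0) → q f = 0 :=
    fun f hf => (hq0 f).mpr (hI ▸ Ideal.mem_sup_right (germ_mem_idealAt.mpr hf))
  have hqa : ∀ {σ : Type} (g : σ → regularFunctions x) (P : MvPolynomial σ ℂ),
      q (MvPolynomial.aeval g P) = MvPolynomial.aeval (fun j => q (g j)) P :=
    fun g P => MvPolynomial.comp_aeval_apply (f := g) q P
  have hqeq : ∀ f g : regularFunctions x, (∀ᶠ y in 𝓝 x, (f : SG → ℂ) y = (g : SG → ℂ) y) →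
      q f = q g := fun f g h => by
    rw [← sub_eq_zero, ← map_sub, hq0, map_sub, germ_eq_iff.mpr h, sub_self]
    exact I.zero_mem
  -- The chart coordinates solve the equations of `T(Y_m)` modulo `I`.
  have hsol : IsSolution m J (fun k => q (t k)) fun k i => q (c k i) := by
    refine ⟨fun k l => ?_, ⟨fun k => ?_, fun k l => ?_⟩, fun i k hi => ?_⟩
    · have h1 : q (c k (J l)) = q (if k = l then 1 else 0) := by
        refine hqeq _ _ (htc.mono fun y hy => ?_)
        rw [hy.normalized k l]
        split_ifs <;> rfl
      rw [h1]
      split_ifs <;> simp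
    · have h1 : q (quad (c k)) = 0 := hqTG _ (htc.mono fun y hy hyT =>
        (hy.mem_TG_iff.mp hyT).1 k)
      rwa [map_quad] at h1
    · have h1 : q (quadPolar (c k) (c l)) = 0 := hqTG _ (htc.mono fun y hy hyT =>
        (hy.mem_TG_iff.mp hyT).2 k l)
      rwa [map_quadPolar] at h1
    · have h1 : q (standardEq t (c k) i) = 0 := by
        refine hqSY _ (htc.mono fun y hy hyS => ?_)
        refine Eq.trans ?_ ((hy.mem_SY_iff hE).mp hyS i k hi)
        exact map_standardEq (regularFunctions.eval x y) t (c k) i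
      rwa [map_standardEq] at h1
  set ζ : Fin d → regularFunctions x := fun j => Sum.elim t (fun q => c q.1 q.2) (S.free j) with hζ
  have hqζ : (fun j => Sum.elim (fun k => q (t k)) (fun r : Fin 3 × Fin 6 => q (c r.1 r.2))
      (S.free j)) = fun j => q (ζ j) := by
    funext j
    simp only [hζ]
    rcases S.free j with k | r <;> rfl
  obtain ⟨ht, hc⟩ := S.solve _ _ hsol
  rw [hqζ] at ht hc
  -- The family of points of `T(Y_m)` with these parameters.
  have hex : ∀ z : Fin d → ℂ, ∃ y, IsChartPoint E J y (fun k => MvPolynomial.eval z (S.t k))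
      fun k i => MvPolynomial.eval z (S.c k i) := fun z =>
    exists_isChartPoint E _ (S.isSolution.map (MvPolynomial.eval z)).normalized
  choose y hy using hex
  have hy0 : y 0 = x := by
    have h0 := hy 0
    simp only [S.t_zero, S.c_zero] at h0
    exact h0.point_unique hx
  have hyTY : ∀ z, y z ∈ TY m := fun z =>
    ((hy z).mem_TY_iff hE).mpr (S.isSolution.map (MvPolynomial.eval z))
  have hζy : ∀ z, IsChartPoint E J (y z) (fun k => (t k : SG → ℂ) (y z))
      (fun k i => (c k i : SG → ℂ) (y z)) → (fun j => (ζ j : SG → ℂ) (y z)) = z := by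
    intro z hz
    obtain ⟨h1, h2⟩ := hz.unique (hy z)
    funext j
    have h3 := congrArg (MvPolynomial.eval z) (S.free_eq j)
    rw [MvPolynomial.eval_X] at h3
    refine Eq.trans ?_ h3
    simp only [hζ]
    rcases S.free j with k | r
    · exact congrFun h1 k
    · exact congrFun (congrFun h2 r.1) r.2
  -- Polynomials in the parameters that vanish on `T(Y_m)` near `x` are zero.
  have hinj : ∀ P : MvPolynomial (Fin d) ℂ,
      germ x (MvPolynomial.aeval ζ P) ∈ idealAt (TY m) x → P = 0 := by
    intro P hP
    have hnear := htc.and (germ_mem_idealAt.mp hP)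
    obtain ⟨Q, hQ, hQ'⟩ := exists_poly_of_mem_nhds hy (z₀ := 0) (by rw [hy0]; exact hnear)
    have hPQ : P * Q = 0 := by
      refine MvPolynomial.funext fun z => ?_
      rw [map_mul, map_zero]
      by_cases hz : MvPolynomial.eval z Q = 0
      · rw [hz, mul_zero]
      · obtain ⟨h1, h2⟩ := hQ' z hz
        have h3 := h2 (hyTY z)
        rw [regularFunctions.aeval_apply, hζy z h1] at h3
        rw [h3, zero_mul]
    refine (mul_eq_zero.mp hPQ).resolve_right fun h => hQ ?_
    rw [h, map_zero]
  have hqunit : ∀ f : regularFunctions x, (f : SG → ℂ) x ≠ 0 → IsUnit (q f) := by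
    intro f hf
    refine IsUnit.of_mul_eq_one (q ⟨_, f.2.inv hf⟩) ?_
    rw [← map_mul, ← map_one q]
    exact hqeq _ _ ((f.2.eventually_ne hf).mono fun y hy => mul_inv_cancel₀ hy)
  -- Polynomials in the parameters that do not vanish at `x` are invertible.
  have hunit : ∀ Q : MvPolynomial (Fin d) ℂ, MvPolynomial.eval 0 Q ≠ 0 →
      IsUnit (MvPolynomial.aeval (fun j => q (ζ j)) Q) := by
    intro Q hQ
    rw [← hqa]
    refine hqunit _ ?_
    have h1 := hζy 0 (by rw [hy0]; exact htc.self_of_nhds)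
    rw [hy0] at h1
    rwa [regularFunctions.aeval_apply, h1]
  -- Modulo `I`, every germ is a quotient of polynomials in the parameters.
  have hsurj : ∀ f : regularFunctions x, ∃ P Q : MvPolynomial (Fin d) ℂ,
      MvPolynomial.eval 0 Q ≠ 0 ∧ q f * MvPolynomial.aeval (fun j => q (ζ j)) Q =
        MvPolynomial.aeval (fun j => q (ζ j)) P := by
    intro f
    obtain ⟨e, P, Q, -, -, hf⟩ := f.2
    -- Modulo `I`, the Plücker coordinates are polynomials in the parameters.
    have hpl : ∀ P : MvPolynomial PluckerIndex ℂ,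
        q (MvPolynomial.aeval (chartPlucker E t c) P) = MvPolynomial.aeval (fun j => q (ζ j))
          (MvPolynomial.aeval (chartPlucker E S.t S.c) P) := by
      intro P
      rw [hqa, MvPolynomial.comp_aeval_apply]
      congr 2
      funext i
      rw [map_chartPlucker, map_chartPlucker]
      congr 1
      · exact funext ht
      · exact funext fun k => funext (hc k)
    have hval : ∀ (y : SG) (F : Frame y),
        (∀ k, (F.a k : V) = hyperplaneFrame E (fun k => (t k : SG → ℂ) y) k) →
        (∀ k, (F.b k : Wedge2) = bivector (hyperplaneFrame E (fun k => (t k : SG → ℂ) y)) (fun i => (c k i : SG → ℂ) y)) →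
        ∀ P : MvPolynomial PluckerIndex ℂ,
          (MvPolynomial.aeval (chartPlucker E t c) P : SG → ℂ) y =
            MvPolynomial.eval F.plucker P := by
      intro y F hF hF' P
      rw [regularFunctions.aeval_apply, plucker_eq_chartPlucker hF hF']
      congr 2
      funext i
      exact map_chartPlucker E (regularFunctions.eval x y) t c i
    refine ⟨MvPolynomial.aeval (chartPlucker E S.t S.c) P,
      MvPolynomial.aeval (chartPlucker E S.t S.c) Q, ?_, ?_⟩
    swap
    · rw [← hpl, ← map_mul]
      rw [hqeq _ (MvPolynomial.aeval (chartPlucker E t c) P), hpl]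
      filter_upwards [htc, hf] with y hty hfy
      obtain ⟨F, hF, hF'⟩ := hty.exists_frame
      obtain ⟨h1, h2⟩ := hfy F
      change (f : SG → ℂ) y * (MvPolynomial.aeval (chartPlucker E t c) Q : SG → ℂ) y = _
      rw [hval y F hF hF', hval y F hF hF', h2, div_mul_cancel₀ _ h1]
    · obtain ⟨F, hF, hF'⟩ := (hy 0).exists_frame
      have h0 : ∀ F : Frame x, MvPolynomial.eval F.plucker Q ≠ 0 := fun F => (hf.self_of_nhds F).1
      rw [← hy0] at h0
      have h1 := h0 F
      rw [plucker_eq_chartPlucker hF hF'] at h1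
      convert h1 using 1
      rw [← MvPolynomial.coe_aeval_eq_eval, ← MvPolynomial.coe_aeval_eq_eval, RingHom.coe_coe,
        RingHom.coe_coe, MvPolynomial.comp_aeval_apply]
      congr 2
      funext i
      rw [map_chartPlucker]
  -- If `f = P / Q` modulo `I` vanishes on `T(Y_m)`, then so does `P`, hence `P = 0`.
  have heq : idealAt (TY m) x = I := by
    refine le_antisymm (fun φ hφ => ?_) hITY
    obtain ⟨f, rfl⟩ := germ_surjective x φ
    obtain ⟨P, Q, hQ, hPQ⟩ := hsurj f
    rw [← hqa, ← hqa, ← map_mul] at hPQ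
    have h1 : germ x (f * MvPolynomial.aeval ζ Q - MvPolynomial.aeval ζ P) ∈ I := by
      rw [← hq0, map_sub, hPQ, sub_self]
    have h2 : P = 0 := by
      refine hinj P ?_
      have h3 := Ideal.sub_mem _ (Ideal.mul_mem_right (germ x (MvPolynomial.aeval ζ Q)) _ hφ)
        (hITY h1)
      rwa [← map_mul, ← map_sub, sub_sub_cancel] at h3
    rw [h2, map_zero, map_zero, map_mul, hqa] at hPQ
    exact (hq0 f).mp ((hunit Q hQ).mul_left_eq_zero.mp hPQ)
  refine ⟨heq, ?_⟩
  -- `M` is the set of polynomials that do not vanish at the origin.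
  let M : Submonoid (MvPolynomial (Fin d) ℂ) :=
    (nonZeroDivisors ℂ).comap (MvPolynomial.eval (0 : Fin d → ℂ))
  have hM : ∀ {Q}, Q ∈ M ↔ MvPolynomial.eval 0 Q ≠ 0 := mem_nonZeroDivisors_iff_ne_zero
  let : Algebra (MvPolynomial (Fin d) ℂ) B :=
    (MvPolynomial.aeval (R := ℂ) fun j => q (ζ j)).toRingHom.toAlgebra
  have halg : ∀ P : MvPolynomial (Fin d) ℂ, algebraMap _ B P =
    MvPolynomial.aeval (fun j => q (ζ j)) P := fun _ => rfl
  have : IsScalarTower ℂ (MvPolynomial (Fin d) ℂ) B :=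
    IsScalarTower.of_algebraMap_eq fun r => by
      rw [halg, MvPolynomial.algebraMap_eq, MvPolynomial.aeval_C]
  have : IsLocalization M B := by
    rw [isLocalization_iff]
    refine ⟨fun Q => hunit Q (hM.mp Q.2), fun r => ?_, fun {P P'} h => ⟨1, ?_⟩⟩
    · obtain ⟨f, rfl⟩ := hqs r
      obtain ⟨P, Q, hQ, hPQ⟩ := hsurj f
      exact ⟨⟨P, Q, hM.mpr hQ⟩, hPQ⟩
    · have h1 : P - P' = 0 := by
        refine hinj _ (hITY ((hq0 _).mp ?_))
        rw [hqa, map_sub, ← halg, ← halg, h, sub_self]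
      rw [sub_eq_zero.mp h1]
  have : Algebra.FormallySmooth (MvPolynomial (Fin d) ℂ) B :=
    Algebra.FormallySmooth.of_isLocalization M
  exact Algebra.FormallySmooth.comp ℂ (MvPolynomial (Fin d) ℂ) _

lemma mkₐ_comp_eq_zero_iff {R A : Type*} [CommRing R] [CommRing A] [Algebra ℂ R] [Algebra ℂ A]
    (g : R →ₐ[ℂ] A) (I : Ideal A) (f : R) :
    (Ideal.Quotient.mkₐ ℂ I).comp g f = 0 ↔ g f ∈ I :=
  Ideal.Quotient.eq_zero_iff_mem

lemma mkₐ_comp_surjective {R A : Type*} [CommRing R] [CommRing A] [Algebra ℂ R] [Algebra ℂ A]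
    {g : R →ₐ[ℂ] A} (hg : Function.Surjective g) (I : Ideal A) :
    Function.Surjective ((Ideal.Quotient.mkₐ ℂ I).comp g) :=
  Ideal.Quotient.mk_surjective.comp hg

open regularFunctions in
/-- Near a point with a parametrized chart, `T(G)` and `S(Y_m)` intersect cleanly. -/
theorem Parametrization.local_structure {m d : ℕ} {J : Fin 3 → Fin 6}
    (S : Parametrization m J d) {E : Module.Basis (Fin 5) ℂ V} (hE : IsAdapted m E) {x : SG}
    (hx : IsChartPoint E J x (fun _ => 0) fun k i => if i = J k then 1 else 0) :
    idealAt (TY m) x = idealAt TG x ⊔ idealAt (SY m) x ∧ IsNonsingularAt (TY m) x := by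
  have h1 := mkₐ_comp_eq_zero_iff (germ x) (idealAt TG x ⊔ idealAt (SY m) x)
  have h2 := mkₐ_comp_surjective (germ_surjective x) (idealAt TG x ⊔ idealAt (SY m) x)
  have key := S.local_structure_aux hE hx rfl
    (B := localRing x ⧸ (idealAt TG x ⊔ idealAt (SY m) x))
    (q := (Ideal.Quotient.mkₐ ℂ (idealAt TG x ⊔ idealAt (SY m) x)).comp (germ x))
    (hqs := h2) (hq0 := h1)
  refine ⟨key.1, ?_⟩
  rw [IsNonsingularAt, key.1]
  exact key.2

/-! ### The five charts -/

open MvPolynomial in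
/-- The chart of `T(Y₅)` at a point `U = E₀ ∧ V₄`; here `E₀` does not lie in the kernel `⟨E₃⟩` of the
alternating form that defines `H₁`. -/
noncomputable def pointChart₅ : Parametrization 5 ![0, 1, 2] 4 where
  t := ![X 3, X 0, X 1, 0]
  c := ![![1, 0, 0, X 0, X 2, 0], ![0, 1, 0, X 1, 0, X 2], ![0, 0, 1, 0, X 1, -X 0]]
  isSolution := by
    refine ⟨fun k l => ?_, ⟨fun k => ?_, fun k l => ?_⟩, fun i k hi => ?_⟩
    · fin_cases k <;> fin_cases l <;> simp
    · fin_cases k <;> simp [quad]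
    · fin_cases k <;> fin_cases l <;> simp [quadPolar]
    · fin_cases i
      · fin_cases k <;> simp [standardEq]
      · simp at hi
  free := ![Sum.inr (0, 3), Sum.inr (1, 3), Sum.inr (0, 4), Sum.inl 0]
  free_eq j := by fin_cases j <;> simp
  t_zero k := by fin_cases k <;> simp
  c_zero k i := by fin_cases k <;> fin_cases i <;> simp
  solve {R} _ _ s e h := by
    obtain ⟨h1, ⟨h2, h3⟩, h4⟩ := h
    simp only [Fin.forall_fin_succ, IsEmpty.forall_iff, and_true] at h1 h2 h3 h4 ⊢
    simp [quad, quadPolar, standardEq] at *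
    grind

open MvPolynomial in
/-- The chart of `T(Y₅)` at a point `U = E₃ ∧ V₄`, where `⟨E₃⟩` is the kernel of the alternating form
that defines `H₁`. -/
noncomputable def kernelChart₅ : Parametrization 5 ![2, 4, 5] 4 where
  t := ![X 1, X 2, X 3, 0]
  c := ![![-(X 0 * X 3), X 0 * X 2, 1, 0, 0, 0], ![X 0, 0, 0, X 0 * X 2, 1, 0],
    ![0, X 0, 0, X 0 * X 3, 0, 1]]
  isSolution := by
    refine ⟨fun k l => ?_, ⟨fun k => ?_, fun k l => ?_⟩, fun i k hi => ?_⟩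
    · fin_cases k <;> fin_cases l <;> simp
    · fin_cases k <;> simp [quad]
    · fin_cases k <;> fin_cases l <;> simp [quadPolar]
    · fin_cases i
      · fin_cases k <;> simp [standardEq]
        ring
      · simp at hi
  free := ![Sum.inr (1, 0), Sum.inl 0, Sum.inl 1, Sum.inl 2]
  free_eq j := by fin_cases j <;> simp
  t_zero k := by fin_cases k <;> simp
  c_zero k i := by fin_cases k <;> fin_cases i <;> simp
  solve {R} _ _ s e h := by
    obtain ⟨h1, ⟨h2, h3⟩, h4⟩ := h
    simp only [Fin.forall_fin_succ, IsEmpty.forall_iff, and_true] at h1 h2 h3 h4 ⊢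
    simp [quad, quadPolar, standardEq] at *
    grind

open MvPolynomial in
/-- The chart of `T(Y₅)` at a point `U = ∧²⟨E₀, E₁, E₃⟩`. -/
noncomputable def planeChart₅ : Parametrization 5 ![0, 2, 4] 4 where
  t := ![X 1, X 2, X 3, 0]
  c := ![![1, X 0, 0, X 2 + X 0 * X 3, 0, 0], ![0, 0, 1, 0, 0, -(X 2 + X 0 * X 3)],
    ![0, 0, 0, 0, 1, X 0]]
  isSolution := by
    refine ⟨fun k l => ?_, ⟨fun k => ?_, fun k l => ?_⟩, fun i k hi => ?_⟩
    · fin_cases k <;> fin_cases l <;> simp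
    · fin_cases k <;> simp [quad]
    · fin_cases k <;> fin_cases l <;> simp [quadPolar]
    · fin_cases i
      · fin_cases k <;> simp [standardEq]
      · simp at hi
  free := ![Sum.inr (0, 1), Sum.inl 0, Sum.inl 1, Sum.inl 2]
  free_eq j := by fin_cases j <;> simp
  t_zero k := by fin_cases k <;> simp
  c_zero k i := by fin_cases k <;> fin_cases i <;> simp
  solve {R} _ _ s e h := by
    obtain ⟨h1, ⟨h2, h3⟩, h4⟩ := h
    simp only [Fin.forall_fin_succ, IsEmpty.forall_iff, and_true] at h1 h2 h3 h4 ⊢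
    simp [quad, quadPolar, standardEq] at *
    grind

open MvPolynomial in
/-- The chart of `T(Y₄)` at a point `U = E₀ ∧ V₄`. -/
noncomputable def pointChart₄ : Parametrization 4 ![0, 1, 2] 1 where
  t := ![0, 0, X 0, 0]
  c := ![![1, 0, 0, 0, X 0 ^ 2, 0], ![0, 1, 0, X 0, 0, X 0 ^ 2], ![0, 0, 1, 0, X 0, 0]]
  isSolution := by
    refine ⟨fun k l => ?_, ⟨fun k => ?_, fun k l => ?_⟩, fun i k hi => ?_⟩
    · fin_cases k <;> fin_cases l <;> simp
    · fin_cases k <;> simp [quad]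
    · fin_cases k <;> fin_cases l <;> simp [quadPolar]
    · fin_cases i <;> fin_cases k <;> simp [standardEq]
      ring
  free := ![Sum.inr (1, 3)]
  free_eq j := by fin_cases j; simp
  t_zero k := by fin_cases k <;> simp
  c_zero k i := by fin_cases k <;> fin_cases i <;> simp
  solve {R} _ _ s e h := by
    obtain ⟨h1, ⟨h2, h3⟩, h4⟩ := h
    simp only [Fin.forall_fin_succ, IsEmpty.forall_iff, and_true] at h1 h2 h3 h4 ⊢
    simp [quad, quadPolar, standardEq] at *
    grind

open MvPolynomial in
/-- The chart of `T(Y₄)` at a point `U = ∧²⟨E₀, E₁, E₃⟩`. -/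
noncomputable def planeChart₄ : Parametrization 4 ![0, 2, 4] 1 where
  t := ![0, 0, X 0, 0]
  c := ![![1, 0, 0, 0, 0, 0], ![0, 0, 1, 0, 0, 0], ![0, 0, 0, 0, 1, 0]]
  isSolution := by
    refine ⟨fun k l => ?_, ⟨fun k => ?_, fun k l => ?_⟩, fun i k hi => ?_⟩
    · fin_cases k <;> fin_cases l <;> simp
    · fin_cases k <;> simp [quad]
    · fin_cases k <;> fin_cases l <;> simp [quadPolar]
    · fin_cases i <;> fin_cases k <;> simp [standardEq]
  free := ![Sum.inl 2]
  free_eq j := by fin_cases j; simp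
  t_zero k := by fin_cases k <;> simp
  c_zero k i := by fin_cases k <;> fin_cases i <;> simp
  solve {R} _ _ s e h := by
    obtain ⟨h1, ⟨h2, h3⟩, h4⟩ := h
    simp only [Fin.forall_fin_succ, IsEmpty.forall_iff, and_true] at h1 h2 h3 h4 ⊢
    simp [quad, quadPolar, standardEq] at *
    grind

/-! ### Extension of bases -/

lemma exists_notMem_of_finrank_lt {M : Type*} [AddCommGroup M] [Module ℂ M] {W W' : Submodule ℂ M}
    [Module.Finite ℂ W'] (h : Module.finrank ℂ W' < Module.finrank ℂ W) : ∃ c ∈ W, c ∉ W' := by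
  by_contra! hc
  exact absurd (Submodule.finrank_mono (show W ≤ W' from hc)) (not_le.mpr h)

lemma exists_snoc {n : ℕ} {W : Submodule ℂ V} (hW : Module.finrank ℂ W = n + 1) {v : Fin n → V}
    (hv : LinearIndependent ℂ v) :
    ∃ c ∈ W, LinearIndependent ℂ (Fin.snoc v c : Fin (n + 1) → V) := by
  obtain ⟨c, hc, hc'⟩ := exists_notMem_of_finrank_lt (W := W)
    (W' := Submodule.span ℂ (Set.range v)) (by
      rw [finrank_span_eq_card hv, hW, Fintype.card_fin]; omega)
  exact ⟨c, hc, linearIndependent_finSnoc.mpr ⟨hv, hc'⟩⟩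

/-- A basis of `V` that extends four independent vectors. -/
lemma exists_basis_extending {b : Fin 4 → V} (hb : LinearIndependent ℂ b) :
    ∃ E : Module.Basis (Fin 5) ℂ V, ∀ k : Fin 4, E k.castSucc = b k := by
  obtain ⟨c, -, hc⟩ := exists_snoc (W := ⊤) (by simp) hb
  refine ⟨basisOfLinearIndependentOfCardEqFinrank hc (by simp), fun k => ?_⟩
  rw [coe_basisOfLinearIndependentOfCardEqFinrank]
  simp

lemma isDualFrame_of_basis {E : Module.Basis (Fin 5) ℂ V} {W : Submodule ℂ V}
    (h : ∀ k : Fin 4, E k.castSucc ∈ W) :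
    IsDualFrame W (fun l => E.coord l.castSucc) fun k : Fin 4 => E k.castSucc :=
  ⟨h, fun k l => by simp [Finsupp.single_apply]⟩

lemma exists_isDualFrame {M : Type*} [AddCommGroup M] [Module ℂ M] {n : ℕ} {W : Submodule ℂ M}
    (B : Module.Basis (Fin n) ℂ W) :
    ∃ Φ : Fin n → M →ₗ[ℂ] ℂ, IsDualFrame W Φ fun k => (B k : M) := by
  choose Φ hΦ using fun l => LinearMap.exists_extend (B.coord l)
  refine ⟨Φ, fun k => (B k).2, fun k l => ?_⟩
  have h := LinearMap.congr_fun (hΦ l) (B k)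
  simp only [LinearMap.comp_apply, Submodule.subtype_apply] at h
  rw [h]
  simp [Finsupp.single_apply]

/-! ### Closedness of `T(G)` and `S(Y_m)` -/

/-- A vector of `U` at `x` extends to a regular section of `U` near `x`. -/
lemma exists_regular_section {x : SG} {u : Wedge2} (hu : u ∈ x.U) : ∃ s : SG → Wedge2, s x = u ∧
    (∀ᶠ y in 𝓝 x, s y ∈ y.U) ∧ ∀ ψ : Wedge2 →ₗ[ℂ] ℂ, RegularAt (fun y => ψ (s y)) x := by
  obtain ⟨F⟩ := Frame.nonempty x
  obtain ⟨Φ, hΦ⟩ := exists_isDualFrame F.b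
  obtain ⟨b, hb, hb'⟩ := exists_regular_dualFrame_U hΦ
  refine ⟨fun y => ∑ k, Φ k u • b k y, (hb.self_of_nhds.eq_sum x.finrank_U hu).symm,
    hb.mono fun y hy => Submodule.sum_mem _ fun k _ => Submodule.smul_mem _ _ (hy.mem k),
    fun ψ => ?_⟩
  have h : (fun y => ψ (∑ k, Φ k u • b k y)) = (fun _ => Φ 0 u) * (fun y => ψ (b 0 y)) +
      (fun _ => Φ 1 u) * (fun y => ψ (b 1 y)) + (fun _ => Φ 2 u) * (fun y => ψ (b 2 y)) := by
    funext y
    simp [Fin.sum_univ_three]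
  rw [h]
  exact (((RegularAt.const _ x).mul (hb' ψ 0)).add ((RegularAt.const _ x).mul (hb' ψ 1))).add
    ((RegularAt.const _ x).mul (hb' ψ 2))

lemma eventually_notMem_SY {m : ℕ} {x : SG} (hx : x ∉ SY m) : ∀ᶠ y in 𝓝 x, y ∉ SY m := by
  rw [mem_SY_iff] at hx
  push Not at hx
  obtain ⟨u, hu, i, hi, hne⟩ := hx
  obtain ⟨s, rfl, hs, hs'⟩ := exists_regular_section hu
  filter_upwards [hs, (hs' (hyperplane i)).eventually_ne hne] with y hy hy' h
  exact hy' (mem_SY_iff.mp h _ hy i hi)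

lemma quad_eq_zero_of_mem_TG {x : SG} (hx : x ∈ TG) (E : Module.Basis (Fin 5) ℂ V) {u : Wedge2}
    (hu : u ∈ x.U) : quad (fun i => pairCoord E i u) = 0 := by
  obtain ⟨v, -, w, -, rfl⟩ := hx u hu
  exact quad_pairCoord_wedge E v w

lemma exists_basis_mem_V4 (x : SG) :
    ∃ E : Module.Basis (Fin 5) ℂ V, ∀ k : Fin 4, E k.castSucc ∈ x.V4 := by
  obtain ⟨F⟩ := Frame.nonempty x
  obtain ⟨E, hE⟩ := exists_basis_extending
    (F.a.linearIndependent.map' x.V4.subtype (Submodule.ker_subtype _))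
  exact ⟨E, fun k => by rw [hE]; exact (F.a k).2⟩

lemma eventually_notMem_TG {x : SG} (hx : x ∉ TG) : ∀ᶠ y in 𝓝 x, y ∉ TG := by
  obtain ⟨E, hE⟩ := exists_basis_mem_V4 x
  have hE' := isDualFrame_of_basis hE
  obtain ⟨u, hu, hne⟩ : ∃ u ∈ x.U, quad (fun i => pairCoord E i u) ≠ 0 := by
    by_contra! h
    refine hx fun u hu => ?_
    rw [eq_bivector hE' x.finrank_V4 (x.U_le hu)]
    exact exists_wedge_of_quad_eq_zero hE'.mem (h u hu)
  obtain ⟨s, rfl, hs, hs'⟩ := exists_regular_section hu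
  have hreg : RegularAt (fun y => quad fun i => pairCoord E i (s y)) x := by
    have h : (fun y => quad fun i => pairCoord E i (s y)) =
        (fun y => pairCoord E 0 (s y)) * (fun y => pairCoord E 5 (s y)) +
        -((fun y => pairCoord E 1 (s y)) * (fun y => pairCoord E 4 (s y))) +
        (fun y => pairCoord E 2 (s y)) * (fun y => pairCoord E 3 (s y)) := by
      funext y
      simp only [quad, Pi.add_apply, Pi.mul_apply, Pi.neg_apply, sub_eq_add_neg]
    rw [h]
    exact (((hs' _).mul (hs' _)).add ((hs' _).mul (hs' _)).neg).add ((hs' _).mul (hs' _))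
  filter_upwards [hs, hreg.eventually_ne hne] with y hy hy' h
  exact hy' (quad_eq_zero_of_mem_TG h E hy)

/-! ### Planes in the Grassmannian of lines -/

lemma wedge_eq_zero_of_mul {v w : V} {a b : ℂ} (h : a • v + b • w = 0) (hab : a ≠ 0 ∨ b ≠ 0) :
    wedge v w = 0 := by
  rcases hab with ha | hb
  · have h1 : wedge (a • v + b • w) w = 0 := by rw [h]; simp [← wedgeₗ_apply]
    rw [wedge_add_left, wedge_smul_left, wedge_smul_left, wedge_self, smul_zero, add_zero] at h1
    exact (smul_eq_zero.mp h1).resolve_left ha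
  · have h1 : wedge v (a • v + b • w) = 0 := by rw [h]; simp [← wedgeₗ_apply]
    rw [wedge_add_right, wedge_smul_right, wedge_smul_right, wedge_self, smul_zero, zero_add] at h1
    exact (smul_eq_zero.mp h1).resolve_left hb

/-- A nonzero vector of the plane `⟨v, w⟩` is a factor of `v ∧ w`. -/
lemma exists_wedge_eq {W : Submodule ℂ V} {v w : V} (hv : v ∈ W) (hw : w ∈ W) {a b : ℂ}
    (hab : a ≠ 0 ∨ b ≠ 0) : ∃ c ∈ W, wedge v w = wedge (a • v + b • w) c := by
  rcases hab with ha | hb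
  · refine ⟨a⁻¹ • w, W.smul_mem _ hw, ?_⟩
    rw [wedge_smul_right, wedge_add_left, wedge_smul_left, wedge_smul_left, wedge_self, smul_zero,
      add_zero, inv_smul_smul₀ ha]
  · refine ⟨-(b⁻¹ • v), W.neg_mem (W.smul_mem _ hv), ?_⟩
    rw [← neg_smul, wedge_smul_right, wedge_add_left, wedge_smul_left, wedge_smul_left, wedge_self,
      smul_zero, zero_add, wedge_swap v w, smul_neg, smul_neg, neg_smul, neg_neg,
      inv_smul_smul₀ hb]

/-- Two bivectors in `U` share a common factor, because their sum is decomposable. -/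
lemma exists_common_factor {x : SG} (hx : x ∈ TG) {u u' : Wedge2} (hu : u ∈ x.U) (hu' : u' ∈ x.U)
    (h0 : u ≠ 0) (h0' : u' ≠ 0) : ∃ v ∈ x.V4, ∃ a ∈ x.V4, ∃ b ∈ x.V4,
      u = wedge v a ∧ u' = wedge v b := by
  obtain ⟨v, hv, w, hw, rfl⟩ := hx u hu
  obtain ⟨v', hv', w', hw', rfl⟩ := hx u' hu'
  -- If the four vectors were independent, `u + u'` would not lie on the Plücker quadric.
  have hdep : ¬ LinearIndependent ℂ ![v, w, v', w'] := by
    intro hli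
    obtain ⟨E, hE⟩ := exists_basis_extending hli
    have h1 := quad_eq_zero_of_mem_TG hx E (x.U.add_mem hu hu')
    have e0 : v = E 0 := (hE 0).symm
    have e1 : w = E 1 := (hE 1).symm
    have e2 : v' = E 2 := (hE 2).symm
    have e3 : w' = E 3 := (hE 3).symm
    rw [e0, e1, e2, e3] at h1
    simp [quad, pairCoord, pairForm_wedge, pairFst, pairSnd] at h1
  rw [Fintype.linearIndependent_iff] at hdep
  push Not at hdep
  obtain ⟨g, hg, i, hi⟩ := hdep
  simp only [Fin.sum_univ_four, Matrix.cons_val] at hg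
  -- A linear relation gives a vector common to the planes `⟨v, w⟩` and `⟨v', w'⟩`.
  have h1 : g 0 ≠ 0 ∨ g 1 ≠ 0 := by
    by_contra! h
    rw [h.1, h.2, zero_smul, zero_smul, zero_add, zero_add] at hg
    refine h0' (wedge_eq_zero_of_mul hg ?_)
    by_contra! h'
    fin_cases i
    exacts [hi h.1, hi h.2, hi h'.1, hi h'.2]
  have h2 : -g 2 ≠ 0 ∨ -g 3 ≠ 0 := by
    by_contra! h
    rw [neg_eq_zero, neg_eq_zero] at h
    rw [h.1, h.2, zero_smul, zero_smul, add_zero, add_zero] at hg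
    exact h0 (wedge_eq_zero_of_mul hg h1)
  obtain ⟨a, ha, ha'⟩ := exists_wedge_eq hv hw h1
  obtain ⟨b, hb, hb'⟩ := exists_wedge_eq hv' hw' h2
  have h3 : g 0 • v + g 1 • w = -g 2 • v' + -g 3 • w' := by
    rw [← sub_eq_zero, ← hg]; module
  exact ⟨_, x.V4.add_mem (x.V4.smul_mem _ hv) (x.V4.smul_mem _ hw), a, ha, b, hb, ha',
    by rw [h3]; exact hb'⟩

/-- A basis of `V` whose first four members span `V₄` and such that `E₀ ∧ E₁` and `E₀ ∧ E₂` are part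
of a basis of `U`. -/
lemma exists_basis_of_mem_TG {x : SG} (hx : x ∈ TG) : ∃ E : Module.Basis (Fin 5) ℂ V,
    (∀ k : Fin 4, E k.castSucc ∈ x.V4) ∧ ∃ u,
      (∀ r : Fin 3 → ℂ, r 0 • wedge (E 0) (E 1) + r 1 • wedge (E 0) (E 2) + r 2 • u = 0 → r = 0) ∧
        wedge (E 0) (E 1) ∈ x.U ∧ wedge (E 0) (E 2) ∈ x.U ∧ u ∈ x.U := by
  obtain ⟨F⟩ := Frame.nonempty x
  have hne : ∀ k, (F.b k : Wedge2) ≠ 0 := fun k h => F.b.ne_zero k (Subtype.ext h)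
  obtain ⟨v, hv, a, ha, b, hb, h0, h1⟩ :=
    exists_common_factor hx (F.b 0).2 (F.b 1).2 (hne 0) (hne 1)
  have hli : ∀ r : Fin 3 → ℂ,
      r 0 • wedge v a + r 1 • wedge v b + r 2 • (F.b 2 : Wedge2) = 0 → r = 0 := by
    intro r hr
    obtain ⟨Φ, hΦ⟩ := exists_isDualFrame F.b
    funext l
    rw [← h0, ← h1] at hr
    have h2 := congrArg (Φ l) hr
    simp only [map_add, map_smul, hΦ.dual, map_zero, smul_eq_mul] at h2
    fin_cases l <;> simpa using h2
  have hv0 : v ≠ 0 := by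
    rintro rfl
    exact hne 0 (by rw [h0]; simp [← wedgeₗ_apply])
  have hvab : LinearIndependent ℂ ![v, a, b] := by
    rw [Fintype.linearIndependent_iff]
    intro g hg
    simp only [Fin.sum_univ_three, Matrix.cons_val] at hg
    have h2 : wedge v (g 0 • v + g 1 • a + g 2 • b) = 0 := by rw [hg]; simp [← wedgeₗ_apply]
    simp only [wedge_add_right, wedge_smul_right, wedge_self, smul_zero, zero_add] at h2
    have h3 := hli ![g 1, g 2, 0] (by
      simp only [Matrix.cons_val, h2, zero_smul, add_zero])
    have h4 : g 1 = 0 := congrFun h3 0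
    have h5 : g 2 = 0 := congrFun h3 1
    rw [h4, h5, zero_smul, zero_smul, add_zero, add_zero] at hg
    have h6 := (smul_eq_zero.mp hg).resolve_right hv0
    intro i
    fin_cases i
    exacts [h6, h4, h5]
  obtain ⟨c, hc, hvabc⟩ := exists_snoc x.finrank_V4 hvab
  obtain ⟨E, hE⟩ := exists_basis_extending hvabc
  have e0 : E 0 = v := hE 0
  have e1 : E 1 = a := hE 1
  have e2 : E 2 = b := hE 2
  have e3 : E 3 = c := hE 3
  refine ⟨E, fun k => ?_, F.b 2, ?_, ?_, ?_, (F.b 2).2⟩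
  · fin_cases k
    exacts [e0 ▸ hv, e1 ▸ ha, e2 ▸ hb, e3 ▸ hc]
  · rwa [e0, e1, e2]
  · rw [e0, e1, ← h0]; exact (F.b 0).2
  · rw [e0, e2, ← h1]; exact (F.b 1).2

/-- A third bivector that meets the pencil `E₀ ∧ E₁`, `E₀ ∧ E₂` either passes through `E₀` or lies
in `⟨E₀, E₁, E₂⟩`. -/
lemma exists_basis_point_or_plane {x : SG} (hx : x ∈ TG) : ∃ E : Module.Basis (Fin 5) ℂ V,
    (∀ k : Fin 4, E k.castSucc ∈ x.V4) ∧ wedge (E 0) (E 1) ∈ x.U ∧ wedge (E 0) (E 2) ∈ x.U ∧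
      (wedge (E 0) (E 3) ∈ x.U ∨ wedge (E 1) (E 2) ∈ x.U) := by
  obtain ⟨E, hmem, u, hli, h01, h02, hu⟩ := exists_basis_of_mem_TG hx
  refine ⟨E, hmem, h01, h02, ?_⟩
  set r : Fin 6 → ℂ := fun i => pairCoord E i u with hr
  have hur : u = r 0 • wedge (E 0) (E 1) + r 1 • wedge (E 0) (E 2) + r 2 • wedge (E 0) (E 3) +
      r 3 • wedge (E 1) (E 2) + r 4 • wedge (E 1) (E 3) + r 5 • wedge (E 2) (E 3) :=
    (eq_bivector (isDualFrame_of_basis hmem) x.finrank_V4 (x.U_le hu)).trans (bivector_eq _ _)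
  have hq : quad r = 0 := quad_eq_zero_of_mem_TG hx E hu
  have hq1 := quad_eq_zero_of_mem_TG hx E (x.U.add_mem hu h01)
  have hq2 := quad_eq_zero_of_mem_TG hx E (x.U.add_mem hu h02)
  simp only [map_add] at hq1 hq2
  change quad (fun i => r i + pairCoord E i _) = 0 at hq1
  change quad (fun i => r i + pairCoord E i _) = 0 at hq2
  simp [quad, pairCoord, pairForm_wedge, pairFst, pairSnd] at hq hq1 hq2
  -- The polar form of the Plücker quadric vanishes at `u` and `E₀ ∧ E₁`, and at `u` and `E₀ ∧ E₂`.
  have h5 : r 5 = 0 := by linear_combination hq1 - hq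
  have h4 : r 4 = 0 := by linear_combination hq - hq2
  rw [h4, h5, zero_smul, zero_smul, add_zero, add_zero] at hur
  rw [h4, h5] at hq
  have hdiff : u - r 0 • wedge (E 0) (E 1) - r 1 • wedge (E 0) (E 2) ∈ x.U :=
    x.U.sub_mem (x.U.sub_mem hu (x.U.smul_mem _ h01)) (x.U.smul_mem _ h02)
  by_cases h2 : r 2 = 0
  · right
    have h3 : r 3 ≠ 0 := by
      intro h3
      rw [h2, h3, zero_smul, zero_smul, add_zero, add_zero] at hur
      have h6 := hli ![r 0, r 1, -1] (by
        simp only [Matrix.cons_val]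
        rw [hur]; module)
      have h7 : (-1 : ℂ) = 0 := congrFun h6 2
      norm_num at h7
    rw [← inv_smul_smul₀ h3 (wedge (E 1) (E 2))]
    refine x.U.smul_mem _ ?_
    convert hdiff using 1
    rw [hur, h2]; module
  · left
    have h3 : r 3 = 0 := by simpa [h2] using hq
    rw [← inv_smul_smul₀ h2 (wedge (E 0) (E 3))]
    refine x.U.smul_mem _ ?_
    convert hdiff using 1
    rw [hur, h3]; module

/-- The two families of planes in `Gr(2, 4)`: lines through a point, and lines in a plane. -/
lemma point_or_plane_of_mem_TG {x : SG} (hx : x ∈ TG) :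
    (∃ v ∈ x.V4, v ≠ 0 ∧ ∀ w ∈ x.V4, wedge v w ∈ x.U) ∨
    (∃ P ≤ x.V4, Module.finrank ℂ P = 3 ∧ ∀ v ∈ P, ∀ w ∈ P, wedge v w ∈ x.U) := by
  obtain ⟨E, hmem, h01, h02, h03 | h12⟩ := exists_basis_point_or_plane hx
  · left
    refine ⟨E 0, hmem 0, E.ne_zero 0, fun w hw => ?_⟩
    rw [(isDualFrame_of_basis hmem).eq_sum x.finrank_V4 hw]
    simp only [Fin.sum_univ_four, wedge_add_right, wedge_smul_right]
    refine x.U.add_mem (x.U.add_mem (x.U.add_mem ?_ ?_) ?_) ?_ <;> refine x.U.smul_mem _ ?_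
    · change wedge (E 0) (E 0) ∈ x.U
      rw [wedge_self]; exact x.U.zero_mem
    · exact h01
    · exact h02
    · exact h03
  · right
    have hli : LinearIndependent ℂ ![E 0, E 1, E 2] := by
      convert E.linearIndependent.comp ![0, 1, 2] (by decide) using 1
      funext k
      fin_cases k <;> rfl
    refine ⟨Submodule.span ℂ (Set.range ![E 0, E 1, E 2]), ?_, ?_, ?_⟩
    · rw [Submodule.span_le]
      rintro _ ⟨k, rfl⟩
      fin_cases k
      exacts [hmem 0, hmem 1, hmem 2]
    · rw [finrank_span_eq_card hli, Fintype.card_fin]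
    · intro p hp q hq
      obtain ⟨p, rfl⟩ := (Submodule.mem_span_range_iff_exists_fun ℂ).mp hp
      obtain ⟨q, rfl⟩ := (Submodule.mem_span_range_iff_exists_fun ℂ).mp hq
      have h6 : wedge (∑ k, p k • ![E 0, E 1, E 2] k) (∑ k, q k • ![E 0, E 1, E 2] k) =
          (p 0 * q 1 - p 1 * q 0) • wedge (E 0) (E 1) +
            (p 0 * q 2 - p 2 * q 0) • wedge (E 0) (E 2) +
            (p 1 * q 2 - p 2 * q 1) • wedge (E 1) (E 2) := by
        simp only [Fin.sum_univ_three, Matrix.cons_val, wedge_add_left, wedge_add_right,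
          wedge_smul_left, wedge_smul_right, wedge_self]
        rw [wedge_swap (E 0) (E 1), wedge_swap (E 0) (E 2), wedge_swap (E 1) (E 2)]
        module
      rw [h6]
      exact x.U.add_mem (x.U.add_mem (x.U.smul_mem _ h01) (x.U.smul_mem _ h02))
        (x.U.smul_mem _ h12)

/-! ### Alternating forms on `V` with one-dimensional kernel -/

lemma exists_eq_add_smul {W W' : Submodule ℂ V} (h : W' ≤ W)
    (hfin : Module.finrank ℂ W = Module.finrank ℂ W' + 1) {c : V} (hc : c ∈ W) (hc' : c ∉ W')
    {w : V} (hw : w ∈ W) : ∃ w' ∈ W', ∃ r : ℂ, w = w' + r • c := by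
  have h1 : W' ⊔ Submodule.span ℂ {c} = W := by
    refine Submodule.eq_of_le_of_finrank_le
      (sup_le h ((Submodule.span_singleton_le_iff_mem _ _).mpr hc)) ?_
    rw [hfin, Nat.succ_le_iff]
    refine Submodule.finrank_lt_finrank_of_lt (lt_of_le_of_ne le_sup_left fun h2 => hc' ?_)
    rw [h2]
    exact Submodule.mem_sup_right (Submodule.mem_span_singleton_self c)
  rw [← h1] at hw
  obtain ⟨w', hw', u, hu, rfl⟩ := Submodule.mem_sup.mp hw
  obtain ⟨r, rfl⟩ := Submodule.mem_span_singleton.mp hu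
  exact ⟨w', hw', r, rfl⟩

lemma finrank_le_finrank_inf_ker (W : Submodule ℂ V) (f : V →ₗ[ℂ] ℂ) :
    Module.finrank ℂ W ≤ Module.finrank ℂ (W ⊓ LinearMap.ker f : Submodule ℂ V) + 1 := by
  have h1 := Submodule.finrank_sup_add_finrank_inf_eq W (LinearMap.ker f)
  have h2 := f.finrank_range_add_finrank_ker
  have h3 := Submodule.finrank_le (LinearMap.range f)
  have h4 := Submodule.finrank_le (W ⊔ LinearMap.ker f)
  simp only [Module.finrank_self, Module.finrank_fin_fun] at h2 h3 h4
  omega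

/-- The linear form `ω(-, g)` of an alternating form `ω`. -/
noncomputable def contractRight (ω : Wedge2 →ₗ[ℂ] ℂ) (g : V) : V →ₗ[ℂ] ℂ :=
  (wedgeₗ.flip g).dualMap ω

section AlternatingForms

variable {ω : Wedge2 →ₗ[ℂ] ℂ}

lemma apply_wedge_add_smul (v w c : V) (r : ℂ) :
    ω (wedge v (w + r • c)) = ω (wedge v w) + r * ω (wedge v c) := by
  rw [wedge_add_right, wedge_smul_right, map_add, map_smul, smul_eq_mul]

lemma exists_notMem {W : Submodule ℂ V} (hW : Module.finrank ℂ W = 4) : ∃ g, g ∉ W := by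
  obtain ⟨g, -, hg⟩ := exists_notMem_of_finrank_lt (W := ⊤) (W' := W) (by simp [hW])
  exact ⟨g, hg⟩

lemma apply_wedge_eq_zero {W : Submodule ℂ V} (hW : Module.finrank ℂ W = 4) {g : V} (hg : g ∉ W)
    {v : V} (h : ∀ w ∈ W, ω (wedge v w) = 0) (h' : ω (wedge v g) = 0) (s : V) :
    ω (wedge v s) = 0 := by
  obtain ⟨w, hw, r, rfl⟩ := exists_eq_add_smul (le_top (a := W)) (by simp [hW])
    (Submodule.mem_top (x := g)) hg (Submodule.mem_top (x := s))
  rw [apply_wedge_add_smul, h w hw, h', mul_zero, add_zero]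

/-- An alternating form with kernel of dimension at most one does not vanish on a hyperplane. -/
lemma exists_apply_wedge_ne_zero {n : V} (hker : ∀ v, (∀ w, ω (wedge v w) = 0) →
      v ∈ Submodule.span ℂ {n}) {W : Submodule ℂ V} (hW : Module.finrank ℂ W = 4) :
    ∃ p ∈ W, ∃ q ∈ W, ω (wedge p q) ≠ 0 := by
  by_contra! h
  -- The orthogonal complement of `g` in `W` would be contained in the kernel; its dimension is three
  -- or more.
  obtain ⟨g, hg⟩ := exists_notMem hW
  have h1 := finrank_le_finrank_inf_ker W (contractRight ω g)
  have h2 : W ⊓ LinearMap.ker (contractRight ω g) ≤ Submodule.span ℂ {n} := fun v hv =>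
    hker v (apply_wedge_eq_zero hW hg (h v hv.1) hv.2)
  have h3 := Submodule.finrank_mono h2
  have h4 := finrank_span_le_card (R := ℂ) ({n} : Set V)
  simp at h4
  omega

/-- A three-dimensional isotropic subspace contains a vector of the kernel. -/
lemma exists_kernel_mem {P W : Submodule ℂ V} (hPW : P ≤ W) (hP : Module.finrank ℂ P = 3)
    (hW : Module.finrank ℂ W = 4) (hiso : ∀ v ∈ P, ∀ w ∈ P, ω (wedge v w) = 0) :
    ∃ k ∈ P, k ≠ 0 ∧ ∀ w, ω (wedge k w) = 0 := by
  obtain ⟨g, hg⟩ := exists_notMem hW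
  obtain ⟨c, hc, hc'⟩ := exists_notMem_of_finrank_lt (W := W) (W' := P) (by omega)
  -- Modulo `P`, the space `V` is spanned by `c` and `g`; in `P`, two conditions leave a line.
  have h1 := finrank_le_finrank_inf_ker P (contractRight ω c)
  have h2 := finrank_le_finrank_inf_ker (P ⊓ LinearMap.ker (contractRight ω c)) (contractRight ω g)
  have h3 : P ⊓ LinearMap.ker (contractRight ω c) ⊓ LinearMap.ker (contractRight ω g) ≠ ⊥ := by
    intro h
    rw [h] at h2
    simp at h2
    omega
  obtain ⟨k, hk, hk0⟩ := Submodule.exists_mem_ne_zero_of_ne_bot h3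
  refine ⟨k, hk.1.1, hk0, apply_wedge_eq_zero hW hg (fun w hw => ?_) hk.2⟩
  obtain ⟨w', hw', r, rfl⟩ := exists_eq_add_smul hPW (by omega) hc hc' hw
  rw [apply_wedge_add_smul, hiso k hk.1.1 w' hw', show ω (wedge k c) = 0 from hk.1.2, mul_zero,
    add_zero]

lemma apply_wedge_swap (v w : V) : ω (wedge w v) = -ω (wedge v w) := by
  rw [wedge_swap, map_neg]

/-- Two linear forms on `∧²V` agree if they agree on the wedges of basis vectors. -/
lemma wedge2_ext_basis (E : Module.Basis (Fin 5) ℂ V) {f g : Wedge2 →ₗ[ℂ] ℂ}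
    (h : ∀ i j, i < j → f (wedge (E i) (E j)) = g (wedge (E i) (E j))) : f = g := by
  have h1 : wedgeₗ.compr₂ f = wedgeₗ.compr₂ g := by
    refine E.ext fun i => E.ext fun j => ?_
    simp only [LinearMap.compr₂_apply, wedgeₗ_apply]
    rcases lt_trichotomy i j with hij | rfl | hij
    · exact h i j hij
    · rw [wedge_self, map_zero, map_zero]
    · rw [wedge_swap (E j) (E i), map_neg, map_neg, h j i hij]
  exact wedge2_ext fun v w => LinearMap.congr_fun₂ h1 v w

/-- Completion of part of a symplectic basis: `r₁`, `r₂` is a hyperbolic pair, `r₀` is orthogonal to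
it but not in the kernel, and `k` is in the kernel. -/
lemma exists_symplectic_basis {r₀ r₁ r₂ k : V} (h01 : ω (wedge r₀ r₁) = 0)
    (h02 : ω (wedge r₀ r₂) = 0) (h12 : ω (wedge r₁ r₂) = 1) (hk : k ≠ 0)
    (hk' : ∀ w, ω (wedge k w) = 0) {s : V} (hs : ω (wedge r₀ s) ≠ 0) :
    ∃ E : Module.Basis (Fin 5) ℂ V, E 0 = r₀ ∧ E 1 = r₁ ∧ E 2 = r₂ ∧ E 3 = k ∧
      ω = standardForm E 0 := by
  -- Normalize `s` and make it orthogonal to the hyperbolic pair `r₁`, `r₂`.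
  obtain ⟨r₄, h04, h14, h24⟩ : ∃ r₄, ω (wedge r₀ r₄) = -1 ∧ ω (wedge r₁ r₄) = 0 ∧
      ω (wedge r₂ r₄) = 0 := by
    set s' := -(ω (wedge r₀ s))⁻¹ • s with hs'
    refine ⟨s' + ω (wedge r₂ s') • r₁ + -ω (wedge r₁ s') • r₂, ?_, ?_, ?_⟩
    · rw [apply_wedge_add_smul, apply_wedge_add_smul, h01, h02, hs', wedge_smul_right, map_smul,
        smul_eq_mul, neg_mul, inv_mul_cancel₀ hs]
      ring
    · rw [apply_wedge_add_smul, apply_wedge_add_smul, wedge_self, map_zero, h12]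
      ring
    · rw [apply_wedge_add_smul, apply_wedge_add_smul, wedge_self, map_zero,
        apply_wedge_swap r₁ r₂, h12]
      ring
  have hk'' : ∀ w, ω (wedge w k) = 0 := fun w => by rw [apply_wedge_swap, hk', neg_zero]
  have hli : LinearIndependent ℂ ![r₀, r₁, r₂, k, r₄] := by
    rw [Fintype.linearIndependent_iff]
    intro g hg
    simp only [Fin.sum_univ_five, Matrix.cons_val] at hg
    have key : ∀ v, g 0 * ω (wedge v r₀) + g 1 * ω (wedge v r₁) + g 2 * ω (wedge v r₂) +
        g 3 * ω (wedge v k) + g 4 * ω (wedge v r₄) = 0 := by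
      intro v
      have h := congrArg (fun w => ω (wedge v w)) hg
      simp only [apply_wedge_add_smul, wedge_smul_right, map_smul, smul_eq_mul] at h
      rw [h]
      simp [← wedgeₗ_apply]
    have k0 := key r₀
    have k1 := key r₁
    have k2 := key r₂
    have k4 := key r₄
    rw [apply_wedge_swap r₀ r₁] at k1
    rw [apply_wedge_swap r₀ r₂, apply_wedge_swap r₁ r₂] at k2
    rw [apply_wedge_swap r₀ r₄, apply_wedge_swap r₁ r₄, apply_wedge_swap r₂ r₄] at k4
    simp only [wedge_self, map_zero, h01, h02, h12, h04, h14, h24, hk''] at k0 k1 k2 k4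
    have g4 : g 4 = 0 := by linear_combination -k0
    have g2 : g 2 = 0 := by linear_combination k1
    have g1 : g 1 = 0 := by linear_combination -k2
    have g0 : g 0 = 0 := by linear_combination k4
    rw [g0, g1, g2, g4] at hg
    simp only [zero_smul, zero_add, add_zero] at hg
    have g3 := (smul_eq_zero.mp hg).resolve_right hk
    intro i
    fin_cases i
    exacts [g0, g1, g2, g3, g4]
  set E := basisOfLinearIndependentOfCardEqFinrank hli (by simp) with hE
  have hE' : ⇑E = ![r₀, r₁, r₂, k, r₄] := coe_basisOfLinearIndependentOfCardEqFinrank _ _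
  have e0 : E 0 = r₀ := by rw [hE']; rfl
  have e1 : E 1 = r₁ := by rw [hE']; rfl
  have e2 : E 2 = r₂ := by rw [hE']; rfl
  have e3 : E 3 = k := by rw [hE']; rfl
  have e4 : E 4 = r₄ := by rw [hE']; rfl
  refine ⟨E, e0, e1, e2, e3, wedge2_ext_basis E fun i j hij => ?_⟩
  have hc : ∀ i j, E.coord i (E j) = if j = i then 1 else 0 := fun i j => by
    simp [Finsupp.single_apply]
  simp only [standardForm, Matrix.cons_val_zero, LinearMap.sub_apply, pairForm_wedge, hc]
  fin_cases i <;> fin_cases j <;>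
    first
    | exact absurd hij (by decide)
    | simp [e0, e1, e2, e3, e4, h01, h02, h12, h04, h14, h24, hk', hk'']

end AlternatingForms

/-! ### Normal forms of the points of `T(Y_m)` -/

lemma hyperplane_zero_wedge (v w : V) : hyperplane 0 (wedge v w) =
    v 1 * w 2 - v 2 * w 1 - (v 0 * w 3 - v 3 * w 0) := by
  simp [hyperplane, p_wedge]

lemma hyperplane_one_wedge (v w : V) : hyperplane 1 (wedge v w) =
    v 1 * w 3 - v 3 * w 1 - (v 2 * w 4 - v 4 * w 2) := by
  simp [hyperplane, p_wedge]

lemma kernel_hyperplane_zero {v : V} (h : ∀ w, hyperplane 0 (wedge v w) = 0) :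
    v 0 = 0 ∧ v 1 = 0 ∧ v 2 = 0 ∧ v 3 = 0 := by
  have h0 := h (Pi.single 0 1)
  have h1 := h (Pi.single 1 1)
  have h2 := h (Pi.single 2 1)
  have h3 := h (Pi.single 3 1)
  rw [hyperplane_zero_wedge] at h0 h1 h2 h3
  simp at h0 h1 h2 h3
  exact ⟨h3, h2, h1, h0⟩

lemma mem_span_of_kernel {v : V} (h : ∀ w, hyperplane 0 (wedge v w) = 0) :
    v ∈ Submodule.span ℂ {(Pi.single 4 1 : V)} := by
  obtain ⟨h0, h1, h2, h3⟩ := kernel_hyperplane_zero h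
  refine Submodule.mem_span_singleton.mpr ⟨v 4, ?_⟩
  ext i
  fin_cases i <;> simp [h0, h1, h2, h3]

lemma mem_span_of_kernel' {v k : V} (hk : k ≠ 0) (hk' : ∀ w, hyperplane 0 (wedge k w) = 0)
    (h : ∀ w, hyperplane 0 (wedge v w) = 0) : v ∈ Submodule.span ℂ {k} := by
  obtain ⟨r, rfl⟩ := Submodule.mem_span_singleton.mp (mem_span_of_kernel hk')
  obtain ⟨s, rfl⟩ := Submodule.mem_span_singleton.mp (mem_span_of_kernel h)
  have hr : r ≠ 0 := by rintro rfl; simp at hk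
  exact Submodule.mem_span_singleton.mpr ⟨s * r⁻¹, by rw [smul_smul, inv_mul_cancel_right₀ hr]⟩

lemma isAdapted_five {E : Module.Basis (Fin 5) ℂ V} (h : hyperplane 0 = standardForm E 0) :
    IsAdapted 5 E := by
  intro u
  have hi : ∀ i : Fin 2, (i : ℕ) + 5 < 6 → i = 0 := fun i hi => by omega
  constructor
  · intro h1 i hi'
    rw [hi i hi', ← h]
    exact h1 0 (by norm_num)
  · intro h1 i hi'
    rw [hi i hi', h]
    exact h1 0 (by norm_num)

lemma exists_smul_pairing {ω : Wedge2 →ₗ[ℂ] ℂ} {W : Submodule ℂ V} {p q : V} (hq : q ∈ W) (h : ω (wedge p q) ≠ 0) :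
    ∃ q' ∈ W, ω (wedge p q') = 1 :=
  ⟨(ω (wedge p q))⁻¹ • q, W.smul_mem _ hq, by
    rw [wedge_smul_right, map_smul, smul_eq_mul, inv_mul_cancel₀ h]⟩

lemma exists_notMem_span_singleton {W : Submodule ℂ V} (hW : 2 ≤ Module.finrank ℂ W) (k : V) :
    ∃ r ∈ W, r ∉ Submodule.span ℂ {k} := by
  refine exists_notMem_of_finrank_lt (lt_of_le_of_lt (finrank_span_le_card ({k} : Set V)) ?_)
  simp only [Set.toFinset_singleton, Finset.card_singleton]
  omega

lemma forall_fin_four {E : Fin 5 → V} {W : Submodule ℂ V} (h0 : E 0 ∈ W) (h1 : E 1 ∈ W)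
    (h2 : E 2 ∈ W) (h3 : E 3 ∈ W) (k : Fin 4) : E k.castSucc ∈ W := by
  fin_cases k
  exacts [h0, h1, h2, h3]

/-- Every point of `T(Y₅)` is a coordinate point for a basis in which the form is standard. -/
lemma exists_basis_of_mem_TY_five {x : SG} (hx : x ∈ TY 5) : ∃ E : Module.Basis (Fin 5) ℂ V,
    IsAdapted 5 E ∧ (∀ k : Fin 4, E k.castSucc ∈ x.V4) ∧
      ((∀ w ∈ x.V4, wedge (E 0) w ∈ x.U) ∨ (∀ w ∈ x.V4, wedge (E 3) w ∈ x.U) ∨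
        (wedge (E 0) (E 1) ∈ x.U ∧ wedge (E 0) (E 3) ∈ x.U ∧ wedge (E 1) (E 3) ∈ x.U)) := by
  have hU : ∀ u ∈ x.U, hyperplane 0 u = 0 := fun u hu =>
    mem_SY_iff.mp hx.1 u hu 0 (by norm_num)
  obtain ⟨p, hp, q, hq, hpq⟩ := exists_apply_wedge_ne_zero (fun v => mem_span_of_kernel) x.finrank_V4
  rcases point_or_plane_of_mem_TG hx.2 with ⟨v, hv, hv0, hvU⟩ | ⟨P, hPV, hP, hPU⟩
  · obtain ⟨q', hq', hpq'⟩ := exists_smul_pairing hq hpq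
    by_cases hker : ∀ w, hyperplane 0 (wedge v w) = 0
    · -- `v` spans the kernel: complete it by a vector orthogonal to `p` and `q'`.
      have h1 := finrank_le_finrank_inf_ker x.V4 (contractRight (hyperplane 0) p)
      have h2 := finrank_le_finrank_inf_ker
        (x.V4 ⊓ LinearMap.ker (contractRight (hyperplane 0) p)) (contractRight (hyperplane 0) q')
      rw [x.finrank_V4] at h1
      obtain ⟨r, hr, hrv⟩ := exists_notMem_span_singleton (W := x.V4 ⊓
        LinearMap.ker (contractRight (hyperplane 0) p) ⊓
        LinearMap.ker (contractRight (hyperplane 0) q')) (by omega) v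
      obtain ⟨s, hs⟩ : ∃ s, hyperplane 0 (wedge r s) ≠ 0 := by
        by_contra! h
        exact hrv (mem_span_of_kernel' hv0 hker h)
      obtain ⟨E, rfl, rfl, rfl, rfl, hE⟩ :=
        exists_symplectic_basis (ω := hyperplane 0) hr.1.2 hr.2 hpq' hv0 hker hs
      exact ⟨E, isAdapted_five hE, forall_fin_four hr.1.1 hp hq' hv, Or.inr (Or.inl hvU)⟩
    · push Not at hker
      obtain ⟨s, hs⟩ := hker
      -- `V₄` is the orthogonal complement of `v`, so it contains the kernel.
      have h4 : (Pi.single 4 1 : V) ∈ x.V4 := by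
        by_contra h
        refine hs (apply_wedge_eq_zero x.finrank_V4 h (fun w hw => hU _ (hvU w hw)) ?_ s)
        rw [hyperplane_zero_wedge]
        simp
      obtain ⟨E, rfl, rfl, rfl, e3, hE⟩ := exists_symplectic_basis (k := Pi.single 4 1)
        (hU _ (hvU p hp)) (hU _ (hvU q' hq')) hpq' (by simp)
        (fun w => by rw [hyperplane_zero_wedge]; simp) hs
      exact ⟨E, isAdapted_five hE, forall_fin_four hv hp hq' (e3 ▸ h4), Or.inl hvU⟩
  · -- An isotropic `P` contains the kernel; a vector `h` of `P` and one of `V₄` outside `P` form a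
    -- hyperbolic pair.
    have hiso : ∀ v ∈ P, ∀ w ∈ P, hyperplane 0 (wedge v w) = 0 := fun v hv w hw =>
      hU _ (hPU v hv w hw)
    obtain ⟨k, hk, hk0, hker⟩ := exists_kernel_mem hPV hP x.finrank_V4 hiso
    obtain ⟨c, hc, hc'⟩ := exists_notMem_of_finrank_lt (W := x.V4) (W' := P) (by
      rw [hP, x.finrank_V4]; norm_num)
    obtain ⟨h, hh, hhc⟩ : ∃ h ∈ P, hyperplane 0 (wedge h c) ≠ 0 := by
      by_contra! h0
      obtain ⟨p', hp', r, rfl⟩ := exists_eq_add_smul hPV (by rw [hP, x.finrank_V4]) hc hc' hp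
      obtain ⟨q', hq', t, rfl⟩ := exists_eq_add_smul hPV (by rw [hP, x.finrank_V4]) hc hc' hq
      refine hpq ?_
      simp only [wedge_add_left, wedge_add_right, wedge_smul_left, wedge_smul_right, map_add,
        map_smul, wedge_self, hiso p' hp' q' hq', h0 p' hp', apply_wedge_swap q' c, h0 q' hq']
      simp
    obtain ⟨c', hc', hhc'⟩ := exists_smul_pairing hc hhc
    have h1 := finrank_le_finrank_inf_ker P (contractRight (hyperplane 0) c')
    obtain ⟨r, hr, hrk⟩ := exists_notMem_span_singleton
      (W := P ⊓ LinearMap.ker (contractRight (hyperplane 0) c')) (by omega) k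
    obtain ⟨s, hs⟩ : ∃ s, hyperplane 0 (wedge r s) ≠ 0 := by
      by_contra! h
      exact hrk (mem_span_of_kernel' hk0 hker h)
    obtain ⟨E, rfl, rfl, rfl, rfl, hE⟩ :=
      exists_symplectic_basis (hiso r hr.1 h hh) hr.2 hhc' hk0 hker hs
    exact ⟨E, isAdapted_five hE, forall_fin_four (hPV hr.1) (hPV hh) hc' (hPV hk),
      Or.inr (Or.inr ⟨hPU _ hr.1 _ hh, hPU _ hr.1 _ hk, hPU _ hh _ hk⟩)⟩

lemma isAdapted_four_of_basis {E : Module.Basis (Fin 5) ℂ V} {a b c d : ℂ} (hdet : a * d - b * c ≠ 0)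
    (h0 : standardForm E 0 = a • hyperplane 0 + b • hyperplane 1)
    (h1 : standardForm E 1 = c • hyperplane 0 + d • hyperplane 1) : IsAdapted 4 E := by
  intro u
  have hi : ∀ i : Fin 2, (i : ℕ) + 4 < 6 := fun i => by omega
  simp only [hi, forall_true_left, Fin.forall_fin_two, h0, h1, LinearMap.add_apply,
    LinearMap.smul_apply, smul_eq_mul]
  constructor
  · rintro ⟨h, h'⟩
    simp [h, h']
  · rintro ⟨h, h'⟩
    constructor
    · refine (mul_eq_zero.mp ?_).resolve_left hdet
      linear_combination d * h - b * h'
    · refine (mul_eq_zero.mp ?_).resolve_left hdet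
      linear_combination a * h' - c * h

lemma standardForm_basis (E : Module.Basis (Fin 5) ℂ V) (j k : Fin 5) :
    standardForm E 0 (wedge (E j) (E k)) = (if j = 1 then 1 else 0) * (if k = 2 then 1 else 0) -
      (if j = 2 then 1 else 0) * (if k = 1 then 1 else 0) -
      ((if j = 0 then 1 else 0) * (if k = 4 then 1 else 0) -
      (if j = 4 then 1 else 0) * (if k = 0 then 1 else 0)) ∧
    standardForm E 1 (wedge (E j) (E k)) = (if j = 1 then 1 else 0) * (if k = 4 then 1 else 0) -
      (if j = 4 then 1 else 0) * (if k = 1 then 1 else 0) -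
      ((if j = 2 then 1 else 0) * (if k = 3 then 1 else 0) -
      (if j = 3 then 1 else 0) * (if k = 2 then 1 else 0)) := by
  have hc : ∀ i j, E.coord i (E j) = if j = i then 1 else 0 := fun i j => by
    simp [Finsupp.single_apply]
  constructor <;> simp only [standardForm, Matrix.cons_val_zero, Matrix.cons_val_one,
    LinearMap.sub_apply, pairForm_wedge, hc]

/-- The basis adapted to the member `α ω₁ + ω₂` of the pencil of alternating forms that defines
`Y₄`: the first vector spans its kernel. -/
lemma exists_adapted_basis_affine (α : ℂ) : ∃ E : Module.Basis (Fin 5) ℂ V, IsAdapted 4 E ∧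
    ⇑E = ![![1, α, 0, 0, -α ^ 2], ![0, 1, 0, 0, -2 * α], ![0, 0, 1, α, 0], ![0, 0, 0, 0, 1],
      ![0, 0, 0, 1, 0]] := by
  have hli : LinearIndependent ℂ (![![1, α, 0, 0, -α ^ 2], ![0, 1, 0, 0, -2 * α], ![0, 0, 1, α, 0],
      ![0, 0, 0, 0, 1], ![0, 0, 0, 1, 0]] : Fin 5 → V) := by
    rw [Fintype.linearIndependent_iff]
    intro g hg
    have h := fun i => congrFun hg i
    simp only [Fin.forall_fin_succ, Fin.sum_univ_five] at h
    simp at h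
    obtain ⟨h0, h1, h2, h3, h4⟩ := h
    simp only [h0, zero_mul, zero_add] at h1
    simp only [h2, zero_mul, zero_add] at h3
    simp only [h0, h1, zero_mul, zero_add, neg_zero] at h4
    intro i
    fin_cases i
    exacts [h0, h1, h2, h4, h3]
  set E := basisOfLinearIndependentOfCardEqFinrank hli (by simp) with hE
  have hE' := coe_basisOfLinearIndependentOfCardEqFinrank hli (by simp)
  refine ⟨E, isAdapted_four_of_basis (a := 1) (b := 0) (c := α) (d := 1) (by simp)
    (wedge2_ext_basis E fun i j hij => ?_) (wedge2_ext_basis E fun i j hij => ?_), hE'⟩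
  · rw [(standardForm_basis E i j).1]
    simp only [LinearMap.add_apply, LinearMap.smul_apply, hyperplane_zero_wedge,
      hyperplane_one_wedge, hE, hE']
    fin_cases i <;> fin_cases j <;> first | exact absurd hij (by decide) | simp
  · rw [(standardForm_basis E i j).2]
    simp only [LinearMap.add_apply, LinearMap.smul_apply, hyperplane_zero_wedge,
      hyperplane_one_wedge, hE, hE']
    fin_cases i <;> fin_cases j <;>
      first | exact absurd hij (by decide) | (simp; done) | (simp; ring)

/-- The basis adapted to the member `ω₁` of the pencil. -/
lemma exists_adapted_basis_infinity : ∃ E : Module.Basis (Fin 5) ℂ V, IsAdapted 4 E ∧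
    ⇑E = ![![0, 0, 0, 0, -1], ![0, 1, 0, 0, 0], ![0, 0, 0, 1, 0], ![-1, 0, 0, 0, 0],
      ![0, 0, 1, 0, 0]] := by
  have hli : LinearIndependent ℂ (![![0, 0, 0, 0, -1], ![0, 1, 0, 0, 0], ![0, 0, 0, 1, 0],
      ![-1, 0, 0, 0, 0], ![0, 0, 1, 0, 0]] : Fin 5 → V) := by
    rw [Fintype.linearIndependent_iff]
    intro g hg
    have h := fun i => congrFun hg i
    simp only [Fin.forall_fin_succ, Fin.sum_univ_five] at h
    simp at h
    obtain ⟨h0, h1, h2, h3, h4⟩ := h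
    intro i
    fin_cases i
    exacts [h4, h1, h3, h0, h2]
  set E := basisOfLinearIndependentOfCardEqFinrank hli (by simp) with hE
  have hE' := coe_basisOfLinearIndependentOfCardEqFinrank hli (by simp)
  refine ⟨E, isAdapted_four_of_basis (a := 0) (b := 1) (c := 1) (d := 0) (by simp)
    (wedge2_ext_basis E fun i j hij => ?_) (wedge2_ext_basis E fun i j hij => ?_), hE'⟩
  · rw [(standardForm_basis E i j).1]
    simp only [LinearMap.add_apply, LinearMap.smul_apply, hyperplane_zero_wedge,
      hyperplane_one_wedge, hE, hE']
    fin_cases i <;> fin_cases j <;> first | exact absurd hij (by decide) | simp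
  · rw [(standardForm_basis E i j).2]
    simp only [LinearMap.add_apply, LinearMap.smul_apply, hyperplane_zero_wedge,
      hyperplane_one_wedge, hE, hE']
    fin_cases i <;> fin_cases j <;> first | exact absurd hij (by decide) | simp

lemma mem_of_apply_eq_zero {W : Submodule ℂ V} (hW : Module.finrank ℂ W = 4) {f : V →ₗ[ℂ] ℂ}
    (h : ∀ w ∈ W, f w = 0) {s : V} (hs : f s ≠ 0) {u : V} (hu : f u = 0) : u ∈ W := by
  by_contra hu'
  obtain ⟨w, hw, r, rfl⟩ := exists_eq_add_smul (le_top (a := W)) (by simp [hW])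
    (Submodule.mem_top (x := u)) hu' (Submodule.mem_top (x := s))
  exact hs (by rw [map_add, map_smul, h w hw, hu, smul_zero, add_zero])

/-- A vector `v` such that both forms `ωᵢ(v, -)` vanish on a hyperplane lies in the kernel of a member
of the pencil, so it lies on the cone over a conic. -/
lemma exists_conic_point {W : Submodule ℂ V} (hW : Module.finrank ℂ W = 4) {v : V} (hv : v ≠ 0)
    (h0 : ∀ w ∈ W, hyperplane 0 (wedge v w) = 0) (h1 : ∀ w ∈ W, hyperplane 1 (wedge v w) = 0) :
    v 2 = 0 ∧ v 3 = 0 ∧ v 0 * v 4 = -v 1 ^ 2 ∧ (v 0 ≠ 0 ∨ v 4 ≠ 0) := by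
  obtain ⟨g, hg⟩ := exists_notMem hW
  -- The member `a ω₁ - b ω₂` of the pencil pairs `v` to zero with the hyperplane and with `g`.
  set a := hyperplane 1 (wedge v g) with ha
  set b := hyperplane 0 (wedge v g) with hb
  have key : ∀ s, a * hyperplane 0 (wedge v s) - b * hyperplane 1 (wedge v s) = 0 :=
    apply_wedge_eq_zero (ω := a • hyperplane 0 - b • hyperplane 1) hW hg
      (fun w hw => by simp [h0 w hw, h1 w hw])
      (by simp only [LinearMap.sub_apply, LinearMap.smul_apply, smul_eq_mul, ← ha, ← hb]; ring)
  have hab : a ≠ 0 ∨ b ≠ 0 := by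
    by_contra! h
    obtain ⟨e0, e1, e2, e3⟩ := kernel_hyperplane_zero (v := v) (apply_wedge_eq_zero hW hg h0 h.2)
    have e4 := apply_wedge_eq_zero (ω := hyperplane 1) hW hg h1 h.1 (Pi.single 2 1)
    rw [hyperplane_one_wedge] at e4
    simp at e4
    refine hv ?_
    ext i
    fin_cases i
    exacts [e0, e1, e2, e3, e4]
  have k0 := key (Pi.single 0 1)
  have k1 := key (Pi.single 1 1)
  have k2 := key (Pi.single 2 1)
  have k3 := key (Pi.single 3 1)
  have k4 := key (Pi.single 4 1)
  simp only [hyperplane_zero_wedge, hyperplane_one_wedge] at k0 k1 k2 k3 k4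
  simp at k0 k1 k2 k3 k4
  have hne : v 0 = 0 → v 4 = 0 → v 1 = 0 → v 2 = 0 → v 3 = 0 → False := fun e0 e4 e1 e2 e3 =>
    hv (by ext i; fin_cases i; exacts [e0, e1, e2, e3, e4])
  grind

/-- Every point of `T(Y₄)` is a coordinate point for a basis in which the pencil is standard. -/
lemma exists_basis_of_mem_TY_four {x : SG} (hx : x ∈ TY 4) : ∃ E : Module.Basis (Fin 5) ℂ V,
    IsAdapted 4 E ∧ (∀ k : Fin 4, E k.castSucc ∈ x.V4) ∧
      ((∀ w ∈ x.V4, wedge (E 0) w ∈ x.U) ∨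
        (wedge (E 0) (E 1) ∈ x.U ∧ wedge (E 0) (E 3) ∈ x.U ∧ wedge (E 1) (E 3) ∈ x.U)) := by
  have hU0 : ∀ u ∈ x.U, hyperplane 0 u = 0 := fun u hu =>
    mem_SY_iff.mp hx.1 u hu 0 (by norm_num)
  have hU1 : ∀ u ∈ x.U, hyperplane 1 u = 0 := fun u hu =>
    mem_SY_iff.mp hx.1 u hu 1 (by norm_num)
  rcases point_or_plane_of_mem_TG hx.2 with ⟨v, hv, hv0, hvU⟩ | ⟨P, hPV, hP, hPU⟩
  · have hw0 : ∀ w ∈ x.V4, hyperplane 0 (wedge v w) = 0 := fun w hw => hU0 _ (hvU w hw)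
    have hw1 : ∀ w ∈ x.V4, hyperplane 1 (wedge v w) = 0 := fun w hw => hU1 _ (hvU w hw)
    obtain ⟨v2, v3, hconic, hne⟩ := exists_conic_point x.finrank_V4 hv0 hw0 hw1
    simp only [hyperplane_zero_wedge, hyperplane_one_wedge, v2, v3] at hw0 hw1
    -- `V₄` is the hyperplane on which the forms `ωᵢ(v, -)` vanish.
    by_cases hv00 : v 0 = 0
    · have v1 : v 1 = 0 := by simpa [hv00] using hconic
      have v4 : v 4 ≠ 0 := hne.resolve_left (not_not.mpr hv00)
      obtain ⟨E, hE, hE'⟩ := exists_adapted_basis_infinity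
      have hmem : ∀ u : V, u 2 = 0 → u ∈ x.V4 := fun u hu =>
        mem_of_apply_eq_zero (f := LinearMap.proj 2) x.finrank_V4 (fun w hw => by
          have := hw1 w hw
          simpa [v1, v4] using this) (s := Pi.single 2 1) (by simp) hu
      refine ⟨E, hE, ?_, Or.inl fun w hw => ?_⟩
      · rw [hE']
        refine forall_fin_four ?_ ?_ ?_ ?_ <;> exact hmem _ (by simp)
      · have h : E 0 = (-(v 4)⁻¹) • v := by
          rw [hE']
          ext i
          fin_cases i <;> simp [hv00, v1, v2, v3, v4]
        rw [h, wedge_smul_left]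
        exact x.U.smul_mem _ (hvU w hw)
    · obtain ⟨E, hE, hE'⟩ := exists_adapted_basis_affine (v 1 / v 0)
      have hmem : ∀ u : V, u 3 - v 1 / v 0 * u 2 = 0 → u ∈ x.V4 := fun u hu =>
        mem_of_apply_eq_zero (f := LinearMap.proj 3 - (v 1 / v 0) • LinearMap.proj 2)
          x.finrank_V4 (fun w hw => by
            have := hw0 w hw
            simp only [LinearMap.sub_apply, LinearMap.smul_apply, LinearMap.proj_apply, smul_eq_mul]
            field_simp
            linear_combination -this) (s := Pi.single 3 1) (by simp) hu
      refine ⟨E, hE, ?_, Or.inl fun w hw => ?_⟩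
      · rw [hE']
        refine forall_fin_four ?_ ?_ ?_ ?_ <;> exact hmem _ (by simp)
      · have h : E 0 = (v 0)⁻¹ • v := by
          rw [hE']
          ext i
          fin_cases i
          · simp [hv00]
          · simp [div_eq_inv_mul]
          · simp [v2]
          · simp [v3]
          · simp
            field_simp
            linear_combination -hconic
        rw [h, wedge_smul_left]
        exact x.U.smul_mem _ (hvU w hw)
  · have hiso0 : ∀ v ∈ P, ∀ w ∈ P, hyperplane 0 (wedge v w) = 0 := fun v hv w hw =>
      hU0 _ (hPU v hv w hw)
    have hiso1 : ∀ v ∈ P, ∀ w ∈ P, hyperplane 1 (wedge v w) = 0 := fun v hv w hw =>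
      hU1 _ (hPU v hv w hw)
    -- The kernels of three members of the pencil span `⟨e₀, e₁, e₄⟩`.
    have h4 : (Pi.single 4 1 : V) ∈ P := by
      obtain ⟨k, hk, hk0, hker⟩ := exists_kernel_mem hPV hP x.finrank_V4 hiso0
      obtain ⟨e0, e1, e2, e3⟩ := kernel_hyperplane_zero hker
      have e4 : k 4 ≠ 0 := fun e4 => hk0 (by ext i; fin_cases i; exacts [e0, e1, e2, e3, e4])
      have h : (Pi.single 4 1 : V) = (k 4)⁻¹ • k := by
        ext i; fin_cases i <;> simp [e0, e1, e2, e3, e4]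
      rw [h]; exact P.smul_mem _ hk
    have h0 : (Pi.single 0 1 : V) ∈ P := by
      obtain ⟨k, hk, hk0, hker⟩ := exists_kernel_mem hPV hP x.finrank_V4 hiso1
      have e1 := hker (Pi.single 3 1)
      have e2 := hker (Pi.single 4 1)
      have e3 := hker (Pi.single 1 1)
      have e4 := hker (Pi.single 2 1)
      rw [hyperplane_one_wedge] at e1 e2 e3 e4
      simp at e1 e2 e3 e4
      have e0 : k 0 ≠ 0 := fun e0 => hk0 (by ext i; fin_cases i; exacts [e0, e1, e2, e3, e4])
      have h : (Pi.single 0 1 : V) = (k 0)⁻¹ • k := by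
        ext i; fin_cases i <;> simp [e0, e1, e2, e3, e4]
      rw [h]; exact P.smul_mem _ hk
    have h1 : (Pi.single 1 1 : V) ∈ P := by
      obtain ⟨k, hk, hk0, hker⟩ := exists_kernel_mem (ω := hyperplane 0 + hyperplane 1) hPV hP
        x.finrank_V4 (fun v hv w hw => by simp [hiso0 v hv w hw, hiso1 v hv w hw])
      have e0 := hker (Pi.single 0 1)
      have e1 := hker (Pi.single 1 1)
      have e2 := hker (Pi.single 2 1)
      have e3 := hker (Pi.single 3 1)
      have e4 := hker (Pi.single 4 1)
      simp only [LinearMap.add_apply, hyperplane_zero_wedge, hyperplane_one_wedge] at e0 e1 e2 e3 e4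
      simp at e0 e1 e2 e3 e4
      have f1 : k 1 ≠ 0 := fun f1 => hk0 (by
        ext i; fin_cases i
        exacts [by simp; linear_combination f1 - e3, f1, e4, e0,
          by simp; linear_combination e2 - f1])
      have h : (Pi.single 1 1 : V) = (k 1)⁻¹ • k + (-(k 1)⁻¹ * k 0) • Pi.single 0 1 +
          (-(k 1)⁻¹ * k 4) • Pi.single 4 1 := by
        ext i; fin_cases i <;> simp [f1, e0, e4]
      rw [h]
      exact P.add_mem (P.add_mem (P.smul_mem _ hk) (P.smul_mem _ h0)) (P.smul_mem _ h4)
    have hspan : ∀ u : V, u 2 = 0 → u 3 = 0 → u ∈ P := by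
      intro u u2 u3
      have h : u = u 0 • Pi.single 0 1 + u 1 • Pi.single 1 1 + u 4 • Pi.single 4 1 := by
        ext i; fin_cases i <;> simp [u2, u3]
      rw [h]
      exact P.add_mem (P.add_mem (P.smul_mem _ h0) (P.smul_mem _ h1)) (P.smul_mem _ h4)
    obtain ⟨c, hc, hc'⟩ := exists_notMem_of_finrank_lt (W := x.V4) (W' := P) (by
      rw [hP, x.finrank_V4]; norm_num)
    -- Modulo `P`, `V₄` is spanned by `c`, and `E₂` has to be a multiple of `c` modulo `P`.
    by_cases c2 : c 2 = 0
    · have c3 : c 3 ≠ 0 := fun c3 => hc' (hspan c c2 c3)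
      obtain ⟨E, hE, hE'⟩ := exists_adapted_basis_infinity
      have m0 : E 0 ∈ P := by rw [hE']; exact hspan _ (by simp) (by simp)
      have m1 : E 1 ∈ P := by rw [hE']; exact hspan _ (by simp) (by simp)
      have m3 : E 3 ∈ P := by rw [hE']; exact hspan _ (by simp) (by simp)
      have m2 : E 2 ∈ x.V4 := by
        have h : E 2 = (c 3)⁻¹ • c + (E 2 - (c 3)⁻¹ • c) := by abel
        rw [h]
        refine x.V4.add_mem (x.V4.smul_mem _ hc) (hPV (hspan _ ?_ ?_)) <;> rw [hE'] <;>
          simp [c2, c3]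
      exact ⟨E, hE, forall_fin_four (hPV m0) (hPV m1) m2 (hPV m3),
        Or.inr ⟨hPU _ m0 _ m1, hPU _ m0 _ m3, hPU _ m1 _ m3⟩⟩
    · obtain ⟨E, hE, hE'⟩ := exists_adapted_basis_affine (c 3 / c 2)
      have m0 : E 0 ∈ P := by rw [hE']; exact hspan _ (by simp) (by simp)
      have m1 : E 1 ∈ P := by rw [hE']; exact hspan _ (by simp) (by simp)
      have m3 : E 3 ∈ P := by rw [hE']; exact hspan _ (by simp) (by simp)
      have m2 : E 2 ∈ x.V4 := by
        have h : E 2 = (c 2)⁻¹ • c + (E 2 - (c 2)⁻¹ • c) := by abel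
        rw [h]
        refine x.V4.add_mem (x.V4.smul_mem _ hc) (hPV (hspan _ ?_ ?_)) <;> rw [hE'] <;>
          simp [c2, div_eq_inv_mul]
      exact ⟨E, hE, forall_fin_four (hPV m0) (hPV m1) m2 (hPV m3),
        Or.inr ⟨hPU _ m0 _ m1, hPU _ m0 _ m3, hPU _ m1 _ m3⟩⟩

/-! ### Clean intersection -/

/-- A coordinate point is the origin of its chart. -/
lemma isChartPoint_origin {x : SG} {E : Module.Basis (Fin 5) ℂ V} {J : Fin 3 → Fin 6}
    (hJ : Function.Injective J) (hV : ∀ k : Fin 4, E k.castSucc ∈ x.V4)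
    (hU : ∀ k, wedge (E (pairFst (J k)).castSucc) (E (pairSnd (J k)).castSucc) ∈ x.U) :
    IsChartPoint E J x (fun _ => 0) fun k i => if i = J k then 1 else 0 := by
  have h : hyperplaneFrame E (fun _ => 0) = fun k => E k.castSucc := by
    funext k
    simp [hyperplaneFrame]
  refine ⟨fun k => by rw [h]; exact hV k, fun k => ?_, fun k l => ?_⟩
  · rw [h]
    simpa [bivector] using hU k
  · simp only [hJ.eq_iff, eq_comm]

lemma wedge_mem_comm {U : Submodule ℂ Wedge2} {v w : V} (h : wedge v w ∈ U) : wedge w v ∈ U := by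
  rw [wedge_swap]
  exact U.neg_mem h

/-- `T(G)` and `S(Y_m)` intersect cleanly at every point of `T(Y_m)`. -/
theorem clean_of_mem_TY {m : ℕ} (hm : m = 4 ∨ m = 5) {x : SG} (hx : x ∈ TY m) :
    idealAt (TY m) x = idealAt TG x ⊔ idealAt (SY m) x ∧ IsNonsingularAt (TY m) x := by
  rcases hm with rfl | rfl
  · obtain ⟨E, hE, hV, h | ⟨h01, h03, h13⟩⟩ := exists_basis_of_mem_TY_four hx
    · refine pointChart₄.local_structure hE (isChartPoint_origin (by decide) hV fun k => ?_)
      fin_cases k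
      exacts [h _ (hV 1), h _ (hV 2), h _ (hV 3)]
    · refine planeChart₄.local_structure hE (isChartPoint_origin (by decide) hV fun k => ?_)
      fin_cases k
      exacts [h01, h03, h13]
  · obtain ⟨E, hE, hV, h | h | ⟨h01, h03, h13⟩⟩ := exists_basis_of_mem_TY_five hx
    · refine pointChart₅.local_structure hE (isChartPoint_origin (by decide) hV fun k => ?_)
      fin_cases k
      exacts [h _ (hV 1), h _ (hV 2), h _ (hV 3)]
    · refine kernelChart₅.local_structure hE (isChartPoint_origin (by decide) hV fun k => ?_)
      fin_cases k
      exacts [wedge_mem_comm (h _ (hV 0)), wedge_mem_comm (h _ (hV 1)), wedge_mem_comm (h _ (hV 2))]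
    · refine planeChart₅.local_structure hE (isChartPoint_origin (by decide) hV fun k => ?_)
      fin_cases k
      exacts [h01, h03, h13]

end QuinticDelPezzo

theorem theorem1p2 (m : ℕ) (hm : m = 4 ∨ m = 5) :
    (∀ x : QuinticDelPezzo.SG,
      QuinticDelPezzo.idealAt (QuinticDelPezzo.TY m) x =
        QuinticDelPezzo.idealAt QuinticDelPezzo.TG x ⊔
          QuinticDelPezzo.idealAt (QuinticDelPezzo.SY m) x) ∧
    (∀ x ∈ QuinticDelPezzo.TY m,
      QuinticDelPezzo.IsNonsingularAt (QuinticDelPezzo.TY m) x) := by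
  refine ⟨fun x => ?_, fun x hx => (QuinticDelPezzo.clean_of_mem_TY hm hx).2⟩
  by_cases hx : x ∈ QuinticDelPezzo.TY m
  · exact (QuinticDelPezzo.clean_of_mem_TY hm hx).1
  -- Away from `T(Y_m)` all ideals in question are the unit ideal.
  · by_cases hS : x ∈ QuinticDelPezzo.SY m
    · have hT := QuinticDelPezzo.eventually_notMem_TG fun hT => hx ⟨hS, hT⟩
      rw [QuinticDelPezzo.idealAt_eq_top hT, top_sup_eq]
      exact QuinticDelPezzo.idealAt_eq_top (hT.mono fun y hy hyT => hy hyT.2)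
    · have hS := QuinticDelPezzo.eventually_notMem_SY hS
      rw [QuinticDelPezzo.idealAt_eq_top hS, sup_top_eq]
      exact QuinticDelPezzo.idealAt_eq_top (hS.mono fun y hy hyT => hy hyT.1)
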